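/- Let $d\ge 1$, $T>0$, and let $L:\mathbb R^d\times\mathbb R^d\times\mathbb R^d\to\mathbb R$, $(x,v,Q)\mapsto L(x,v,Q)$, be of class $C^2$. Suppose that there are constants $c>0$ and $M\ge 0$ such that 1. $D_xL$ is not identically zero; 2. $D^2_{(x,v)}L\ge c$, i.e. for all $x,v,Q$ the Hessian of $L(\cdot,\cdot,Q)$ at $(x,v)$ satisfies $\langle D^2_{(x,v)}L(x,v,Q)(\xi,\eta),(\xi,\eta)\rangle\ge c\,(|\xi|^2+|\eta|^2)$ for all $\xi,\eta\in\mathbb R^d$; 3. $\|D^2_{vQ}L(x,v,Q)\|\le M$ and $\|D^2_{xQ}L(x,v,Q)\|\le M$ (operator norms) for all $x,v,Q$, and $c^2>2M^2$. Let $g:\mathbb R^d\to\mathbb R$ be twice differentiable with $D^2g\ge 0$, and let $m_0$ be a Borel probability measure on $\mathbb R^d$. For $Q\in L^2([0,T],\mathbb R^d)$ and $x_0\in\mathbb R^d$ consider the Euler--Lagrange system $$\frac{d}{dt}D_vL(x(t),\dot x(t),Q(t))=D_xL(x(t),\dot x(t),Q(t)),\qquad x(0)=x_0,\qquad D_vL(x(T),\dot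 x(T),Q(T))=-Dg(x(T)),$$ where a solution is an absolutely continuous $x:[0,T]\to\mathbb R^d$ such that $t\mapsto D_xL(x(t),\dot x(t),Q(t))$ is integrable and $t\mapsto D_vL(x(t),\dot x(t),Q(t))$ agrees a.e. with an absolutely continuous function $p$ with $p'(t)=D_xL(x(t),\dot x(t),Q(t))$ for a.e. $t$ and $p(T)=-Dg(x(T))$. Denote the solution by $x(\cdot\,;x_0,Q)$ and define the error map $$E[Q](t)=Q(t)+\int_{\mathbb R^d}\dot x(t;x_0,Q)\,dm_0(x_0).$$ Say that $E$ is defined at $Q$ if $\dot x(t;x_0,Q)$ is $m_0$-integrable in $x_0$ for a.e. $t\in[0,T]$ and $E[Q]\in L^2([0,T],\mathbb R^d)$. Assume that $E$ is defined at some $Q\in L^2([0,T],\mathbb R^d)$. Then for every $Q\in L^2([0,T],\mathbb R^d)$ the Euler--Lagrange system has exactly one solution for every $x_0\in\mathbb R^d$, and $E$ is defined at $Q$. Moreover, $E$ is strongly monotone: there is $\delta<1$ such that for all $Q_0,Q_1\in L^2([0,T],\mathbb R^d)$ $$\int_0^T\big(E[Q_1](t)-E[Q_0](t)\big)\cdot\big(Q_1(t)-Q_0(t)\big)\,dt\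 \ge\ (1-\delta)\int_0^T|Q_1(t)-Q_0(t)|^2\,dt .$$ -/

import Mathlib

open MeasureTheory Set

noncomputable section

/-- The partial gradient `D_x L(x, v, Q)`. -/
def gradX {d : ℕ}
    (L : EuclideanSpace ℝ (Fin d) → EuclideanSpace ℝ (Fin d) → EuclideanSpace ℝ (Fin d) → ℝ)
    (x v Q : EuclideanSpace ℝ (Fin d)) : EuclideanSpace ℝ (Fin d) :=
  gradient (fun x' => L x' v Q) x

/-- The partial gradient `D_v L(x, v, Q)`. -/
def gradV {d : ℕ}
    (L : EuclideanSpace ℝ (Fin d) → EuclideanSpace ℝ (Fin d) → EuclideanSpace ℝ (Fin d) → ℝ)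
    (x v Q : EuclideanSpace ℝ (Fin d)) : EuclideanSpace ℝ (Fin d) :=
  gradient (fun v' => L x v' Q) v

/-- The standing assumption on an `x`-dependent Lagrangian, with convexity constant `c` and
bound `M` for the operator norms of the mixed second derivatives `D²_{vQ} L` and `D²_{xQ} L`. -/
structure LagrangianAssumption {d : ℕ}
    (L : EuclideanSpace ℝ (Fin d) → EuclideanSpace ℝ (Fin d) → EuclideanSpace ℝ (Fin d) → ℝ)
    (c M : ℝ) : Prop where
  /-- `L` is jointly `C²`. -/
  contDiff : ContDiff ℝ 2
    (fun z : EuclideanSpace ℝ (Fin d) × EuclideanSpace ℝ (Fin d) × EuclideanSpace ℝ (Fin d) =>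
      L z.1 z.2.1 z.2.2)
  /-- `D_x L` is not identically zero, i.e. `L` does depend on `x`. -/
  gradX_ne_zero : ∃ x v Q, gradX L x v Q ≠ 0
  c_pos : 0 < c
  /-- `D²_{(x,v)} L ≥ c` as quadratic forms in `(ξ, η)`. -/
  convex : ∀ x v Q ξ η : EuclideanSpace ℝ (Fin d),
    c * (‖ξ‖ ^ 2 + ‖η‖ ^ 2) ≤
      fderiv ℝ (fderiv ℝ
        (fun z : EuclideanSpace ℝ (Fin d) × EuclideanSpace ℝ (Fin d) => L z.1 z.2 Q))
        (x, v) (ξ, η) (ξ, η)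
  bound_vQ : ∀ x v Q, ‖fderiv ℝ (fun Q' => gradV L x v Q') Q‖ ≤ M
  bound_xQ : ∀ x v Q, ‖fderiv ℝ (fun Q' => gradX L x v Q') Q‖ ≤ M
  dominance : 2 * M ^ 2 < c ^ 2

/-- `x` solves on `[0, T]` the Euler–Lagrange system
`d/dt D_v L(x, ẋ, Q) = D_x L(x, ẋ, Q)`, `x(0) = x₀`, `D_v L(x, ẋ, Q)(T) = - Dg(x(T))`.
Since `Q` is only square integrable, this is meant in the Carathéodory sense: `x` is absolutely
continuous (it is the integral of its derivative), and `D_v L(x, ẋ, Q)` agrees almost everywhere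
with an absolutely continuous function `p` with `p' = D_x L(x, ẋ, Q)`, which carries the terminal
condition. -/
structure IsEulerLagrangeSolution {d : ℕ}
    (L : EuclideanSpace ℝ (Fin d) → EuclideanSpace ℝ (Fin d) → EuclideanSpace ℝ (Fin d) → ℝ)
    (g : EuclideanSpace ℝ (Fin d) → ℝ) (T : ℝ) (Q : ℝ → EuclideanSpace ℝ (Fin d))
    (x₀ : EuclideanSpace ℝ (Fin d)) (x : ℝ → EuclideanSpace ℝ (Fin d)) : Prop where
  velocity_integrable : IntervalIntegrable (deriv x) volume 0 T
  eq_integral : ∀ t ∈ Icc (0 : ℝ) T, x t = x₀ + ∫ s in (0 : ℝ)..t, deriv x s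
  force_integrable :
    IntervalIntegrable (fun s => gradX L (x s) (deriv x s) (Q s)) volume 0 T
  exists_momentum : ∃ p : ℝ → EuclideanSpace ℝ (Fin d),
    (∀ᵐ t ∂(volume.restrict (Icc (0 : ℝ) T)), gradV L (x t) (deriv x t) (Q t) = p t) ∧
    (∀ t ∈ Icc (0 : ℝ) T,
      p t = p 0 + ∫ s in (0 : ℝ)..t, gradX L (x s) (deriv x s) (Q s)) ∧
    p T = - gradient g (x T)

open Classical in
/-- The trajectory `x(·; x₀, Q)`: the solution of the Euler–Lagrange system
(only its values on `[0, T]` matter). -/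
def trajectory {d : ℕ}
    (L : EuclideanSpace ℝ (Fin d) → EuclideanSpace ℝ (Fin d) → EuclideanSpace ℝ (Fin d) → ℝ)
    (g : EuclideanSpace ℝ (Fin d) → ℝ) (T : ℝ) (Q : ℝ → EuclideanSpace ℝ (Fin d))
    (x₀ : EuclideanSpace ℝ (Fin d)) : ℝ → EuclideanSpace ℝ (Fin d) :=
  if h : ∃ x, IsEulerLagrangeSolution L g T Q x₀ x then h.choose else fun _ => 0

/-- The error map `E[Q](t) = Q(t) + ∫ ẋ(t; x₀, Q) dm₀(x₀)`. -/
def errorMap {d : ℕ}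
    (L : EuclideanSpace ℝ (Fin d) → EuclideanSpace ℝ (Fin d) → EuclideanSpace ℝ (Fin d) → ℝ)
    (g : EuclideanSpace ℝ (Fin d) → ℝ) (T : ℝ) (m₀ : Measure (EuclideanSpace ℝ (Fin d)))
    (Q : ℝ → EuclideanSpace ℝ (Fin d)) : ℝ → EuclideanSpace ℝ (Fin d) :=
  fun t => Q t + ∫ x₀, deriv (trajectory L g T Q x₀) t ∂m₀

/-- `E[Q]` makes sense as an element of `L²([0, T], ℝᵈ)`: the integral that defines `E[Q](t)`
converges absolutely for almost every `t`, and `E[Q]` is square integrable. -/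
structure ErrorMapDefinedAt {d : ℕ}
    (L : EuclideanSpace ℝ (Fin d) → EuclideanSpace ℝ (Fin d) → EuclideanSpace ℝ (Fin d) → ℝ)
    (g : EuclideanSpace ℝ (Fin d) → ℝ) (T : ℝ) (m₀ : Measure (EuclideanSpace ℝ (Fin d)))
    (Q : ℝ → EuclideanSpace ℝ (Fin d)) : Prop where
  integrable : ∀ᵐ t ∂(volume.restrict (Icc (0 : ℝ) T)),
    Integrable (fun x₀ => deriv (trajectory L g T Q x₀) t) m₀
  memLp : MemLp (errorMap L g T m₀ Q) 2 (volume.restrict (Icc (0 : ℝ) T))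

end

/-!
The Euler–Lagrange system is the optimality condition of a convex variational problem: minimize
the action `∫ L(x, ẋ, Q) dt + g(x(T))` among the curves with `x(0) = x₀`. The difficulty is that
`L` may grow arbitrarily fast in `(x, v)`, so the action can be infinite on a dense set of curves,
and it need not be differentiable on `H¹`; the control is merely square integrable, so there is no
pointwise bound on the velocity either. Joint convexity replaces regularity at each step.

*Existence of minimizers* (`exists_isMinimizer`). After a shift by a function of the control
alone, `L` is nonnegative and coercive (`coerciveLagrangian`). The action is strongly convex in
the velocity (`action_combo_le`), so minimizing sequences are Cauchy in `L²`, and Fatou's lemma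
shows that the limit is a minimizer. The minimal action is a finite convex function of the
starting point (`convexOn_valueFunction`); hence it is continuous and has subgradients.

*Minimizers are solutions* (`IsMinimizer.isEulerLagrangeSolution`). Subtracting the linear
functional of a subgradient turns the minimizer into a minimizer without constraint on the starting point.
Along segments to curves of finite action, the difference quotients of the action are monotone, so
the first variation exists and is integrable (`IsMinimizer.integrable_variation`). All Lipschitz
curves have finite action, so the first variation vanishes in Lipschitz directions
(`IsMinimizer.weak_eulerLagrange`). Constant and affine directions give the integrability of
`D_x L` and of `D_v L` along the minimizer, and the du Bois-Reymond lemma gives the equation together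
with the terminal condition.

*Stability* (`IsEulerLagrangeSolution.integral_norm_deriv_sub_sq_le`). The gradient of `L` in
`(x, v)` is strongly monotone with constant `c` and `M`-Lipschitz in the control in each of its two
components. Integrated along two solutions with the same starting point, this bounds `‖ẋ₁ - ẋ₀‖²`
in `L²` by `2 M² / c²` times `‖Q₁ - Q₀‖²`. Equal controls give uniqueness.

*The error map*. Strong convexity and continuity of the value function make the trajectories
continuous in `(x₀, t)` (`continuous_trajectory`), so the velocities are jointly measurable. The
stability bound is uniform in `x₀`; by Tonelli's theorem and Jensen's inequality the difference of
two mean velocities is in `L²` with the same bound (`exists_memLp_mean_velocity_sub`). This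
transports the definedness of the error map from one control to all others, and it yields strong
monotonicity because `2 M² / c² < 1`.
-/

/-! ### Convex functions with a lower bound on the Hessian -/

/-- A lower bound for the Hessian in the direction `h` bounds the growth of the derivative in that
direction. -/
theorem le_fderiv_sub_fderiv_of_le_hessian {F : Type*} [NormedAddCommGroup F] [NormedSpace ℝ F]
    {G : F → ℝ} (hG' : Differentiable ℝ (fderiv ℝ G)) {h : F} {m : ℝ}
    (hm : ∀ z, m ≤ fderiv ℝ (fderiv ℝ G) z h h) (z : F) {s : ℝ} (hs : 0 ≤ s) :
    s * m ≤ fderiv ℝ G (z + s • h) h - fderiv ℝ G z h := by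
  have hder : ∀ r : ℝ, HasDerivAt (fun r : ℝ => fderiv ℝ G (z + r • h) h)
      (fderiv ℝ (fderiv ℝ G) (z + r • h) h h) r := by
    intro r
    have h1 : HasDerivAt (fun r : ℝ => z + r • h) h r := by
      simpa using ((hasDerivAt_id r).smul_const h).const_add z
    have h2 := (hG' (z + r • h)).hasFDerivAt.comp_hasDerivAt r h1
    simpa using h2.clm_apply (hasDerivAt_const r h)
  have := Convex.mul_sub_le_image_sub_of_le_deriv (D := univ) convex_univ
    (f := fun r : ℝ => fderiv ℝ G (z + r • h) h)
    (fun r _ => (hder r).continuousAt.continuousWithinAt)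
    (fun r _ => (hder r).differentiableAt.differentiableWithinAt)
    (C := m) (fun r _ => by rw [(hder r).deriv]; exact hm _) 0 (mem_univ _) s (mem_univ _) hs
  simpa [mul_comm] using this

theorem add_fderiv_add_le_of_le_hessian {F : Type*} [NormedAddCommGroup F] [NormedSpace ℝ F]
    {G : F → ℝ} (hG : Differentiable ℝ G) (hG' : Differentiable ℝ (fderiv ℝ G)) {h : F} {m : ℝ}
    (hm : ∀ z, m ≤ fderiv ℝ (fderiv ℝ G) z h h) (z : F) :
    G z + fderiv ℝ G z h + m / 2 ≤ G (z + h) := by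
  have hder : ∀ r : ℝ, HasDerivAt
      (fun r : ℝ => G (z + r • h) - r * fderiv ℝ G z h - r ^ 2 * (m / 2))
      (fderiv ℝ G (z + r • h) h - fderiv ℝ G z h - r * m) r := by
    intro r
    have h1 : HasDerivAt (fun r : ℝ => z + r • h) h r := by
      simpa using ((hasDerivAt_id r).smul_const h).const_add z
    have h2 := (hG (z + r • h)).hasFDerivAt.comp_hasDerivAt r h1
    have h3 := (h2.sub ((hasDerivAt_id r).mul_const (fderiv ℝ G z h))).sub
      ((hasDerivAt_pow 2 r).mul_const (m / 2))
    convert! h3 using 1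
    simp; ring
  have := monotoneOn_of_deriv_nonneg (D := Ici (0 : ℝ)) (convex_Ici 0)
    (fun r _ => (hder r).continuousAt.continuousWithinAt)
    (fun r _ => (hder r).differentiableAt.differentiableWithinAt)
    (fun r hr => by
      rw [(hder r).deriv]
      have := le_fderiv_sub_fderiv_of_le_hessian hG' hm z (interior_subset hr : r ∈ Ici (0 : ℝ))
      linarith)
    (mem_Ici.2 le_rfl) (mem_Ici.2 zero_le_one) zero_le_one
  simp at this
  linarith

theorem inner_gradient_eq_fderiv {F : Type*} [NormedAddCommGroup F] [InnerProductSpace ℝ F]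
    [CompleteSpace F] (G : F → ℝ) (z h : F) : inner ℝ (gradient G z) h = fderiv ℝ G z h := by
  simp [gradient]

/-! ### Pointwise estimates for the Lagrangian -/

/-- The Euclidean space in which positions, velocities and controls take their values. -/
abbrev Vec (d : ℕ) := EuclideanSpace ℝ (Fin d)

variable {d : ℕ}

namespace LagrangianAssumption

variable {L : Vec d → Vec d → Vec d → ℝ} {c M : ℝ}

theorem gradX_eq (hL : LagrangianAssumption L c M) (x v Q : Vec d) :
    gradX L x v Q = (InnerProductSpace.toDual ℝ (Vec d)).symm
      ((fderiv ℝ (fun z : Vec d × Vec d × Vec d => L z.1 z.2.1 z.2.2) (x, v, Q)).comp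
        (ContinuousLinearMap.inl ℝ (Vec d) (Vec d × Vec d))) := by
  unfold gradX gradient
  congr 1
  have h1 : HasFDerivAt (fun x' : Vec d => (x', v, Q))
    (ContinuousLinearMap.inl ℝ (Vec d) (Vec d × Vec d)) x := hasFDerivAt_prodMk_left x (v, Q)
  have h2 := ((hL.contDiff.differentiable (by norm_num)) (x, v, Q)).hasFDerivAt
  exact (h2.comp x h1).fderiv

theorem gradV_eq (hL : LagrangianAssumption L c M) (x v Q : Vec d) :
    gradV L x v Q = (InnerProductSpace.toDual ℝ (Vec d)).symm
      ((fderiv ℝ (fun z : Vec d × Vec d × Vec d => L z.1 z.2.1 z.2.2) (x, v, Q)).comp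
        ((ContinuousLinearMap.inr ℝ (Vec d) (Vec d × Vec d)).comp
          (ContinuousLinearMap.inl ℝ (Vec d) (Vec d)))) := by
  unfold gradV gradient
  congr 1
  have h1 : HasFDerivAt (fun v' : Vec d => (x, v', Q))
    ((ContinuousLinearMap.inr ℝ (Vec d) (Vec d × Vec d)).comp
          (ContinuousLinearMap.inl ℝ (Vec d) (Vec d))) v :=
    (hasFDerivAt_prodMk_right x (v, Q)).comp v (hasFDerivAt_prodMk_left v Q)
  have h2 := ((hL.contDiff.differentiable (by norm_num)) (x, v, Q)).hasFDerivAt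
  exact (h2.comp v h1).fderiv

theorem contDiff_gradX (hL : LagrangianAssumption L c M) :
    ContDiff ℝ 1 (fun z : Vec d × Vec d × Vec d => gradX L z.1 z.2.1 z.2.2) := by
  simp_rw [hL.gradX_eq]
  have h1 := hL.contDiff.fderiv_right (m := 1) (by norm_num)
  exact (LinearIsometryEquiv.contDiff _).comp (h1.clm_comp contDiff_const)

theorem contDiff_gradV (hL : LagrangianAssumption L c M) :
    ContDiff ℝ 1 (fun z : Vec d × Vec d × Vec d => gradV L z.1 z.2.1 z.2.2) := by
  simp_rw [hL.gradV_eq]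
  have h1 := hL.contDiff.fderiv_right (m := 1) (by norm_num)
  exact (LinearIsometryEquiv.contDiff _).comp (h1.clm_comp contDiff_const)

theorem norm_gradX_sub_le (hL : LagrangianAssumption L c M) (x v Q₀ Q₁ : Vec d) :
    ‖gradX L x v Q₁ - gradX L x v Q₀‖ ≤ M * ‖Q₁ - Q₀‖ :=
  convex_univ.norm_image_sub_le_of_norm_fderiv_le (f := fun Q => gradX L x v Q)
    (fun Q _ => (hL.contDiff_gradX.differentiable one_ne_zero (x, v, Q)).comp Q
      (f := fun Q => (x, v, Q)) (by fun_prop))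
    (fun Q _ => hL.bound_xQ x v Q) (mem_univ _) (mem_univ _)

theorem norm_gradV_sub_le (hL : LagrangianAssumption L c M) (x v Q₀ Q₁ : Vec d) :
    ‖gradV L x v Q₁ - gradV L x v Q₀‖ ≤ M * ‖Q₁ - Q₀‖ :=
  convex_univ.norm_image_sub_le_of_norm_fderiv_le (f := fun Q => gradV L x v Q)
    (fun Q _ => (hL.contDiff_gradV.differentiable one_ne_zero (x, v, Q)).comp Q
      (f := fun Q => (x, v, Q)) (by fun_prop))
    (fun Q _ => hL.bound_vQ x v Q) (mem_univ _) (mem_univ _)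

theorem bound_nonneg (hL : LagrangianAssumption L c M) : 0 ≤ M :=
  (norm_nonneg _).trans (hL.bound_vQ 0 0 0)

theorem contDiff_state (hL : LagrangianAssumption L c M) (Q : Vec d) :
    ContDiff ℝ 2 (fun z : Vec d × Vec d => L z.1 z.2 Q) :=
  hL.contDiff.comp (f := fun z : Vec d × Vec d => (z.1, z.2, Q)) (by fun_prop)

theorem fderiv_state (hL : LagrangianAssumption L c M) (x v Q ξ η : Vec d) :
    fderiv ℝ (fun z : Vec d × Vec d => L z.1 z.2 Q) (x, v) (ξ, η) =
      inner ℝ (gradX L x v Q) ξ + inner ℝ (gradV L x v Q) η := by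
  have h2 := ((hL.contDiff_state Q).differentiable (by norm_num) (x, v)).hasFDerivAt
  have hx := (h2.comp x (hasFDerivAt_prodMk_left (𝕜 := ℝ) x v)).fderiv
  have hv := (h2.comp v (hasFDerivAt_prodMk_right (𝕜 := ℝ) x v)).fderiv
  unfold gradX gradV
  rw [inner_gradient_eq_fderiv, inner_gradient_eq_fderiv]
  change fderiv ℝ (fun x' => L x' v Q) x = _ at hx
  change fderiv ℝ (fun v' => L x v' Q) v = _ at hv
  rw [hx, hv]
  simp [← map_add]

theorem monotone_grad (hL : LagrangianAssumption L c M) (x₀ v₀ x₁ v₁ Q : Vec d) :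
    c * (‖x₁ - x₀‖ ^ 2 + ‖v₁ - v₀‖ ^ 2) ≤
      inner ℝ (gradX L x₁ v₁ Q - gradX L x₀ v₀ Q) (x₁ - x₀) +
        inner ℝ (gradV L x₁ v₁ Q - gradV L x₀ v₀ Q) (v₁ - v₀) := by
  have h := le_fderiv_sub_fderiv_of_le_hessian
    (((hL.contDiff_state Q).fderiv_right (m := 1) (by norm_num)).differentiable one_ne_zero)
    (h := (x₁ - x₀, v₁ - v₀)) (fun z => hL.convex z.1 z.2 Q _ _) (x₀, v₀) zero_le_one
  have e : ((x₀, v₀) : Vec d × Vec d) + (1 : ℝ) • (x₁ - x₀, v₁ - v₀) = (x₁, v₁) := by simp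
  rw [e, hL.fderiv_state, hL.fderiv_state, one_mul] at h
  simp only [inner_sub_left] at h ⊢
  linarith

theorem add_inner_grad_le (hL : LagrangianAssumption L c M) (x₀ v₀ x₁ v₁ Q : Vec d) :
    L x₀ v₀ Q + inner ℝ (gradX L x₀ v₀ Q) (x₁ - x₀) + inner ℝ (gradV L x₀ v₀ Q) (v₁ - v₀) +
      c / 2 * (‖x₁ - x₀‖ ^ 2 + ‖v₁ - v₀‖ ^ 2) ≤ L x₁ v₁ Q := by
  have h := add_fderiv_add_le_of_le_hessian ((hL.contDiff_state Q).differentiable (by norm_num))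
    (((hL.contDiff_state Q).fderiv_right (m := 1) (by norm_num)).differentiable one_ne_zero)
    (h := (x₁ - x₀, v₁ - v₀)) (fun z => hL.convex z.1 z.2 Q _ _) (x₀, v₀)
  have e : ((x₀, v₀) : Vec d × Vec d) + (x₁ - x₀, v₁ - v₀) = (x₁, v₁) := by simp
  rw [e, hL.fderiv_state] at h
  linarith

/-- The coupling term costs at most half of the strong convexity: this is where the mixed
derivatives in `Q` enter, through Young's inequality. -/
theorem monotone_grad_param (hL : LagrangianAssumption L c M) (x₀ v₀ x₁ v₁ Q₀ Q₁ : Vec d) :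
    c / 2 * (‖x₁ - x₀‖ ^ 2 + ‖v₁ - v₀‖ ^ 2) ≤
      inner ℝ (gradX L x₁ v₁ Q₁ - gradX L x₀ v₀ Q₀) (x₁ - x₀) +
        inner ℝ (gradV L x₁ v₁ Q₁ - gradV L x₀ v₀ Q₀) (v₁ - v₀) +
        M ^ 2 / c * ‖Q₁ - Q₀‖ ^ 2 := by
  have h := hL.monotone_grad x₀ v₀ x₁ v₁ Q₁
  have hX : -(M * ‖Q₁ - Q₀‖ * ‖x₁ - x₀‖) ≤
      inner ℝ (gradX L x₀ v₀ Q₁ - gradX L x₀ v₀ Q₀) (x₁ - x₀) :=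
    neg_le_of_abs_le ((abs_real_inner_le_norm _ _).trans
      (mul_le_mul_of_nonneg_right (hL.norm_gradX_sub_le _ _ _ _) (norm_nonneg _)))
  have hV : -(M * ‖Q₁ - Q₀‖ * ‖v₁ - v₀‖) ≤
      inner ℝ (gradV L x₀ v₀ Q₁ - gradV L x₀ v₀ Q₀) (v₁ - v₀) :=
    neg_le_of_abs_le ((abs_real_inner_le_norm _ _).trans
      (mul_le_mul_of_nonneg_right (hL.norm_gradV_sub_le _ _ _ _) (norm_nonneg _)))
  have young : ∀ a : ℝ, M * ‖Q₁ - Q₀‖ * a ≤ c / 2 * a ^ 2 + M ^ 2 / c * ‖Q₁ - Q₀‖ ^ 2 / 2 := by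
    intro a
    have hc := hL.c_pos
    have e : c / 2 * a ^ 2 + M ^ 2 / c * ‖Q₁ - Q₀‖ ^ 2 / 2 - M * ‖Q₁ - Q₀‖ * a =
        (c * a - M * ‖Q₁ - Q₀‖) ^ 2 / (2 * c) := by
      field_simp; ring
    have : 0 ≤ (c * a - M * ‖Q₁ - Q₀‖) ^ 2 / (2 * c) := by positivity
    linarith
  have y1 := young ‖x₁ - x₀‖
  have y2 := young ‖v₁ - v₀‖
  simp only [inner_sub_left] at h hX hV ⊢
  linarith

end LagrangianAssumption

/-- The Lagrangian shifted, for each value of the control, by a constant that makes it coercive and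
nonnegative: `(c / 4) * (‖x‖² + ‖v‖²)` is a lower bound. The shift does not change the gradients in
`(x, v)`, and it makes the action of bounded curves finite, which the integral of `L` itself
need not be, since `L 0 0` is an arbitrary function of the control. -/
noncomputable def coerciveLagrangian (L : Vec d → Vec d → Vec d → ℝ) (c : ℝ) (x v Q : Vec d) : ℝ :=
  L x v Q - L 0 0 Q + (‖gradX L 0 0 Q‖ ^ 2 + ‖gradV L 0 0 Q‖ ^ 2) / c

namespace LagrangianAssumption

variable {L : Vec d → Vec d → Vec d → ℝ} {c M : ℝ}

theorem continuous_coerciveLagrangian (hL : LagrangianAssumption L c M) :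
    Continuous (fun z : Vec d × Vec d × Vec d => coerciveLagrangian L c z.1 z.2.1 z.2.2) := by
  have h0 : Continuous (fun z : Vec d × Vec d × Vec d => ((0 : Vec d), (0 : Vec d), z.2.2)) := by
    fun_prop
  have h1 := hL.contDiff.continuous
  have h2 := h1.comp h0
  have h3 := hL.contDiff_gradX.continuous.comp h0
  have h4 := hL.contDiff_gradV.continuous.comp h0
  unfold coerciveLagrangian
  exact (h1.sub h2).add (((h3.norm.pow 2).add (h4.norm.pow 2)).div_const c)

theorem le_coerciveLagrangian (hL : LagrangianAssumption L c M) (x v Q : Vec d) :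
    c / 4 * (‖x‖ ^ 2 + ‖v‖ ^ 2) ≤ coerciveLagrangian L c x v Q := by
  have hc := hL.c_pos
  have h := hL.add_inner_grad_le 0 0 x v Q
  simp only [sub_zero] at h
  have young : ∀ a b : Vec d, -(‖a‖ ^ 2 / c + c / 4 * ‖b‖ ^ 2) ≤ inner ℝ a b := by
    intro a b
    have h1 := neg_le_of_abs_le (abs_real_inner_le_norm a b)
    have e : ‖a‖ ^ 2 / c + c / 4 * ‖b‖ ^ 2 - ‖a‖ * ‖b‖ = (2 * ‖a‖ - c * ‖b‖) ^ 2 / (4 * c) := by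
      field_simp; ring
    have : 0 ≤ (2 * ‖a‖ - c * ‖b‖) ^ 2 / (4 * c) := by positivity
    linarith
  have y1 := young (gradX L 0 0 Q) x
  have y2 := young (gradV L 0 0 Q) v
  unfold coerciveLagrangian
  rw [add_div]
  linarith

theorem coerciveLagrangian_nonneg (hL : LagrangianAssumption L c M) (x v Q : Vec d) :
    0 ≤ coerciveLagrangian L c x v Q :=
  le_trans (by have := hL.c_pos; positivity) (hL.le_coerciveLagrangian x v Q)

theorem coerciveLagrangian_add_inner_grad_le (hL : LagrangianAssumption L c M)
    (x₀ v₀ x₁ v₁ Q : Vec d) :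
    coerciveLagrangian L c x₀ v₀ Q + inner ℝ (gradX L x₀ v₀ Q) (x₁ - x₀) +
      inner ℝ (gradV L x₀ v₀ Q) (v₁ - v₀) + c / 2 * (‖x₁ - x₀‖ ^ 2 + ‖v₁ - v₀‖ ^ 2) ≤
      coerciveLagrangian L c x₁ v₁ Q := by
  have h := hL.add_inner_grad_le x₀ v₀ x₁ v₁ Q
  unfold coerciveLagrangian
  linarith

theorem coerciveLagrangian_combo_le (hL : LagrangianAssumption L c M)
    (x₀ v₀ x₁ v₁ Q : Vec d) {θ : ℝ} (h0 : 0 ≤ θ) (h1 : θ ≤ 1) :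
    coerciveLagrangian L c (x₀ + θ • (x₁ - x₀)) (v₀ + θ • (v₁ - v₀)) Q +
      c / 2 * (θ * (1 - θ)) * (‖x₁ - x₀‖ ^ 2 + ‖v₁ - v₀‖ ^ 2) ≤
      (1 - θ) * coerciveLagrangian L c x₀ v₀ Q + θ * coerciveLagrangian L c x₁ v₁ Q := by
  have a := hL.coerciveLagrangian_add_inner_grad_le (x₀ + θ • (x₁ - x₀)) (v₀ + θ • (v₁ - v₀))
    x₀ v₀ Q
  have b := hL.coerciveLagrangian_add_inner_grad_le (x₀ + θ • (x₁ - x₀)) (v₀ + θ • (v₁ - v₀))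
    x₁ v₁ Q
  have e0 : ∀ p q : Vec d, p - (p + θ • (q - p)) = (-θ) • (q - p) := by
    intro p q; module
  have e1 : ∀ p q : Vec d, q - (p + θ • (q - p)) = (1 - θ) • (q - p) := by
    intro p q; module
  simp only [e0, e1, inner_smul_right, norm_smul, mul_pow, Real.norm_eq_abs, sq_abs] at a b
  have a' := mul_le_mul_of_nonneg_left a (sub_nonneg.2 h1)
  have b' := mul_le_mul_of_nonneg_left b h0
  linarith

/-- On bounded sets of `(x, v)` the shifted Lagrangian grows at most quadratically in the control,
so that bounded curves have finite action for square integrable controls. -/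
theorem exists_coerciveLagrangian_le (hL : LagrangianAssumption L c M) (R : ℝ) :
    ∃ C : ℝ, ∀ x v Q : Vec d, ‖x‖ ≤ R → ‖v‖ ≤ R →
      coerciveLagrangian L c x v Q ≤ C * (1 + ‖Q‖ ^ 2) := by
  have hc := hL.c_pos
  have hM := hL.bound_nonneg
  obtain ⟨B₁, hB₁⟩ := ((isCompact_closedBall (0 : Vec d) (max R 0)).prod
    (isCompact_closedBall (0 : Vec d) (max R 0))).exists_bound_of_continuousOn
    (f := fun z : Vec d × Vec d => gradX L z.1 z.2 0)
    (hL.contDiff_gradX.continuous.comp (f := fun z : Vec d × Vec d => (z.1, z.2, (0 : Vec d)))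
      (by fun_prop)).continuousOn
  obtain ⟨B₂, hB₂⟩ := ((isCompact_closedBall (0 : Vec d) (max R 0)).prod
    (isCompact_closedBall (0 : Vec d) (max R 0))).exists_bound_of_continuousOn
    (f := fun z : Vec d × Vec d => gradV L z.1 z.2 0)
    (hL.contDiff_gradV.continuous.comp (f := fun z : Vec d × Vec d => (z.1, z.2, (0 : Vec d)))
      (by fun_prop)).continuousOn
  set B := max B₁ B₂
  set S := max R 0
  have hX : ∀ x v Q : Vec d, ‖x‖ ≤ S → ‖v‖ ≤ S → ‖gradX L x v Q‖ ≤ B + M * ‖Q‖ := by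
    intro x v Q hx hv
    have h1 := hL.norm_gradX_sub_le x v 0 Q
    have h2 : ‖gradX L x v 0‖ ≤ B₁ := hB₁ (x, v) ⟨by simpa using hx, by simpa using hv⟩
    have h3 := norm_le_norm_add_norm_sub' (gradX L x v Q) (gradX L x v 0)
    rw [sub_zero] at h1
    have := le_max_left B₁ B₂
    linarith
  have hV : ∀ x v Q : Vec d, ‖x‖ ≤ S → ‖v‖ ≤ S → ‖gradV L x v Q‖ ≤ B + M * ‖Q‖ := by
    intro x v Q hx hv
    have h1 := hL.norm_gradV_sub_le x v 0 Q
    have h2 : ‖gradV L x v 0‖ ≤ B₂ := hB₂ (x, v) ⟨by simpa using hx, by simpa using hv⟩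
    have h3 := norm_le_norm_add_norm_sub' (gradV L x v Q) (gradV L x v 0)
    rw [sub_zero] at h1
    have := le_max_right B₁ B₂
    linarith
  have hS : 0 ≤ S := le_max_right _ _
  refine ⟨(2 * S + 2 / c) * (1 + 2 * (B ^ 2 + M ^ 2)), fun x v Q hx hv => ?_⟩
  replace hx : ‖x‖ ≤ S := hx.trans (le_max_left _ _)
  replace hv : ‖v‖ ≤ S := hv.trans (le_max_left _ _)
  have h := hL.add_inner_grad_le x v 0 0 Q
  simp only [zero_sub, inner_neg_right, norm_neg] at h
  have hnn : 0 ≤ c / 2 * (‖x‖ ^ 2 + ‖v‖ ^ 2) := by positivity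
  set w := B + M * ‖Q‖
  have hw : 0 ≤ w := (norm_nonneg _).trans (hX 0 0 Q (by simpa) (by simpa))
  have i1 : inner ℝ (gradX L x v Q) x ≤ w * S := (real_inner_le_norm _ _).trans
    (mul_le_mul (hX x v Q hx hv) hx (norm_nonneg _) hw)
  have i2 : inner ℝ (gradV L x v Q) v ≤ w * S := (real_inner_le_norm _ _).trans
    (mul_le_mul (hV x v Q hx hv) hv (norm_nonneg _) hw)
  have i3 : ‖gradX L 0 0 Q‖ ^ 2 ≤ w ^ 2 :=
    pow_le_pow_left₀ (norm_nonneg _) (hX 0 0 Q (by simpa) (by simpa)) 2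
  have i4 : ‖gradV L 0 0 Q‖ ^ 2 ≤ w ^ 2 :=
    pow_le_pow_left₀ (norm_nonneg _) (hV 0 0 Q (by simpa) (by simpa)) 2
  have i5 : (‖gradX L 0 0 Q‖ ^ 2 + ‖gradV L 0 0 Q‖ ^ 2) / c ≤ (w ^ 2 + w ^ 2) / c := by gcongr
  have j1 : w ≤ 1 + w ^ 2 := by nlinarith [sq_nonneg (w - 1)]
  have j2 : w ^ 2 ≤ 2 * (B ^ 2 + M ^ 2) * (1 + ‖Q‖ ^ 2) := by
    have : w ^ 2 ≤ 2 * (B ^ 2 + M ^ 2 * ‖Q‖ ^ 2) := by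
      simp only [w]; nlinarith [sq_nonneg (B - M * ‖Q‖)]
    nlinarith [mul_nonneg (sq_nonneg B) (sq_nonneg ‖Q‖), sq_nonneg M]
  have j3 : 1 + w ^ 2 ≤ (1 + 2 * (B ^ 2 + M ^ 2)) * (1 + ‖Q‖ ^ 2) := by
    nlinarith [sq_nonneg ‖Q‖]
  calc coerciveLagrangian L c x v Q ≤ w * S + w * S + (w ^ 2 + w ^ 2) / c := by
        unfold coerciveLagrangian; linarith
    _ = 2 * S * w + 2 / c * w ^ 2 := by ring
    _ ≤ 2 * S * (1 + w ^ 2) + 2 / c * (1 + w ^ 2) := by gcongr; linarith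
    _ = (2 * S + 2 / c) * (1 + w ^ 2) := by ring
    _ ≤ (2 * S + 2 / c) * ((1 + 2 * (B ^ 2 + M ^ 2)) * (1 + ‖Q‖ ^ 2)) := by gcongr
    _ = _ := by ring

theorem hasDerivAt_coerciveLagrangian (hL : LagrangianAssumption L c M) (x v Q ξ η : Vec d) :
    HasDerivAt (fun θ : ℝ => coerciveLagrangian L c (x + θ • ξ) (v + θ • η) Q)
      (inner ℝ (gradX L x v Q) ξ + inner ℝ (gradV L x v Q) η) 0 := by
  have h2 := ((hL.contDiff_state Q).differentiable (by norm_num)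
    (x + (0 : ℝ) • ξ, v + (0 : ℝ) • η)).hasFDerivAt
  have h1 : ∀ p q : Vec d, HasDerivAt (fun θ : ℝ => p + θ • q) q 0 := fun p q => by
    simpa using ((hasDerivAt_id (0 : ℝ)).smul_const q).const_add p
  have h3 := h2.comp_hasDerivAt (0 : ℝ) ((h1 x ξ).prodMk (h1 v η))
  simp only [zero_smul, add_zero, hL.fderiv_state] at h3
  exact (h3.sub_const (L 0 0 Q)).add_const _

end LagrangianAssumption

/-! ### The terminal cost -/

section TerminalCost

variable {g : Vec d → ℝ}

theorem add_inner_gradient_le (hg : Differentiable ℝ g) (hg' : Differentiable ℝ (fderiv ℝ g))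
    (hg'' : ∀ x ξ, 0 ≤ fderiv ℝ (fderiv ℝ g) x ξ ξ) (x y : Vec d) :
    g x + inner ℝ (gradient g x) (y - x) ≤ g y := by
  have h := add_fderiv_add_le_of_le_hessian hg hg' (h := y - x) (fun z => hg'' z _) x
  rw [add_sub_cancel, ← inner_gradient_eq_fderiv] at h
  linarith

theorem inner_gradient_sub_nonneg (hg : Differentiable ℝ g) (hg' : Differentiable ℝ (fderiv ℝ g))
    (hg'' : ∀ x ξ, 0 ≤ fderiv ℝ (fderiv ℝ g) x ξ ξ) (x y : Vec d) :
    0 ≤ inner ℝ (gradient g y - gradient g x) (y - x) := by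
  have h1 := add_inner_gradient_le hg hg' hg'' x y
  have h2 := add_inner_gradient_le hg hg' hg'' y x
  rw [← neg_sub y x, inner_neg_right] at h2
  rw [inner_sub_left]
  linarith

theorem convexOn_of_hessian_nonneg (hg : Differentiable ℝ g)
    (hg' : Differentiable ℝ (fderiv ℝ g))
    (hg'' : ∀ x ξ, 0 ≤ fderiv ℝ (fderiv ℝ g) x ξ ξ) : ConvexOn ℝ univ g := by
  refine ⟨convex_univ, fun x _ y _ a b ha hb hab => ?_⟩
  have h1 := add_inner_gradient_le hg hg' hg'' (a • x + b • y) x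
  have h2 := add_inner_gradient_le hg hg' hg'' (a • x + b • y) y
  obtain rfl : a = 1 - b := by linarith
  have e1 : x - ((1 - b) • x + b • y) = (-b) • (y - x) := by module
  have e2 : y - ((1 - b) • x + b • y) = (1 - b) • (y - x) := by module
  rw [e1, inner_smul_right] at h1
  rw [e2, inner_smul_right] at h2
  simp only [smul_eq_mul]
  have a' := mul_le_mul_of_nonneg_left h1 ha
  have b' := mul_le_mul_of_nonneg_left h2 hb
  linarith

end TerminalCost

/-! ### Facts from integration theory and convex analysis -/

section Generic

open Filter Topology

theorem integrable_and_integral_le_of_tendsto {α : Type*} [MeasurableSpace α] {μ : Measure α}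
    {F : ℕ → α → ℝ} {f : α → ℝ} (hF : ∀ n, Integrable (F n) μ) (h0 : ∀ n, 0 ≤ᵐ[μ] F n)
    (hlim : ∀ᵐ a ∂μ, Tendsto (fun n => F n a) atTop (𝓝 (f a))) {B : ℕ → ℝ} {b : ℝ}
    (hB : ∀ n, ∫ a, F n a ∂μ ≤ B n) (hb : Tendsto B atTop (𝓝 b)) :
    Integrable f μ ∧ ∫ a, f a ∂μ ≤ b := by
  have hf0 : 0 ≤ᵐ[μ] f := by
    filter_upwards [hlim, ae_all_iff.2 h0] with a ha h0a
    exact ge_of_tendsto' ha h0a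
  have hfm : AEStronglyMeasurable f μ :=
    aestronglyMeasurable_of_tendsto_ae atTop (fun n => (hF n).aestronglyMeasurable) hlim
  have key : ∫⁻ a, ENNReal.ofReal (f a) ∂μ ≤ ENNReal.ofReal b := by
    calc ∫⁻ a, ENNReal.ofReal (f a) ∂μ
        = ∫⁻ a, liminf (fun n => ENNReal.ofReal (F n a)) atTop ∂μ := by
          refine lintegral_congr_ae ?_
          filter_upwards [hlim] with a ha
          exact ((ENNReal.continuous_ofReal.tendsto _).comp ha).liminf_eq.symm
      _ ≤ liminf (fun n => ∫⁻ a, ENNReal.ofReal (F n a) ∂μ) atTop :=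
          lintegral_liminf_le' fun n => (hF n).aestronglyMeasurable.aemeasurable.ennreal_ofReal
      _ ≤ liminf (fun n => ENNReal.ofReal (B n)) atTop := by
          refine liminf_le_liminf (Eventually.of_forall fun n => ?_)
          rw [← ofReal_integral_eq_lintegral_ofReal (hF n) (h0 n)]
          exact ENNReal.ofReal_le_ofReal (hB n)
      _ = ENNReal.ofReal b := ((ENNReal.continuous_ofReal.tendsto _).comp hb).liminf_eq
  have hb0 : 0 ≤ b := ge_of_tendsto' hb fun n => (integral_nonneg_of_ae (h0 n)).trans (hB n)
  have hfi : Integrable f μ := ⟨hfm, by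
    rw [hasFiniteIntegral_iff_ofReal hf0]
    exact key.trans_lt ENNReal.ofReal_lt_top⟩
  refine ⟨hfi, ?_⟩
  rwa [← ofReal_integral_eq_lintegral_ofReal hfi hf0, ENNReal.ofReal_le_ofReal_iff hb0] at key

theorem sq_integral_le_measureReal_mul {α : Type*} [MeasurableSpace α] {μ : Measure α}
    [IsFiniteMeasure μ] {f : α → ℝ} (hf : MemLp f 2 μ) :
    (∫ a, f a ∂μ) ^ 2 ≤ μ.real univ * ∫ a, f a ^ 2 ∂μ := by
  rcases eq_or_ne μ 0 with rfl | hμ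
  · simp
  have hA : 0 < μ.real univ := by
    rw [measureReal_def]
    exact ENNReal.toReal_pos (by simpa using hμ) (measure_ne_top _ _)
  have h1 : Integrable f μ := hf.integrable one_le_two
  have h2 : Integrable (fun a => f a ^ 2) μ := hf.integrable_sq
  set A := μ.real univ
  set I := ∫ a, f a ∂μ
  have h : 0 ≤ ∫ a, (A * f a - I) ^ 2 ∂μ := integral_nonneg fun a => sq_nonneg _
  have e : ∫ a, (A * f a - I) ^ 2 ∂μ = A ^ 2 * ∫ a, f a ^ 2 ∂μ - 2 * A * I * I + I ^ 2 * A := by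
    have : ∀ a, (A * f a - I) ^ 2 = A ^ 2 * f a ^ 2 - 2 * A * I * f a + I ^ 2 := fun a => by ring
    simp_rw [this]
    have i1 : Integrable (fun a => A ^ 2 * f a ^ 2) μ := h2.const_mul _
    have i2 : Integrable (fun a => 2 * A * I * f a) μ := h1.const_mul _
    rw [integral_add (i1.sub' i2) (integrable_const _), integral_sub i1 i2, integral_const_mul,
      integral_const_mul, integral_const, smul_eq_mul, mul_comm (μ.real univ)]
  rw [e] at h
  have : 0 ≤ A * (A * ∫ a, f a ^ 2 ∂μ - I ^ 2) := by linarith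
  linarith [nonneg_of_mul_nonneg_right this hA]

theorem intervalIntegral_mul_primitive {u w U W : ℝ → ℝ} {a b T : ℝ} (hT : 0 ≤ T)
    (hu : IntervalIntegrable u volume 0 T) (hw : IntervalIntegrable w volume 0 T)
    (hU : ∀ t ∈ Icc 0 T, U t = a + ∫ s in (0 : ℝ)..t, u s)
    (hW : ∀ t ∈ Icc 0 T, W t = b + ∫ s in (0 : ℝ)..t, w s) :
    ∫ t in (0 : ℝ)..T, (u t * W t + U t * w t) = U T * W T - U 0 * W 0 := by
  have hac : ∀ {k : ℝ → ℝ} (r : ℝ), IntervalIntegrable k volume 0 T →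
      AbsolutelyContinuousOnInterval (fun t => r + ∫ s in (0 : ℝ)..t, k s) 0 T := fun r hk =>
    AbsolutelyContinuousOnInterval.add (f := fun _ => r)
      ((LipschitzWith.const r).lipschitzOnWith.absolutelyContinuousOnInterval)
      (hk.absolutelyContinuousOnInterval_intervalIntegral (c := 0) (by simp))
  have h := (hac a hu).integral_deriv_mul_eq_sub (hac b hw)
  rw [hU T ⟨hT, le_rfl⟩, hW T ⟨hT, le_rfl⟩, hU 0 ⟨le_rfl, hT⟩, hW 0 ⟨le_rfl, hT⟩, ← h]
  refine intervalIntegral.integral_congr_ae ?_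
  filter_upwards [hu.ae_hasDerivAt_integral, hw.ae_hasDerivAt_integral] with t h1 h2 ht
  have ht' : t ∈ uIcc 0 T := uIoc_subset_uIcc ht
  rw [((h1 ht' 0 left_mem_uIcc).const_add a).deriv, ((h2 ht' 0 left_mem_uIcc).const_add b).deriv]
  rw [uIcc_of_le hT] at ht'
  rw [hU t ht', hW t ht']

/-- Integration by parts for the inner product of two absolutely continuous curves. -/
theorem intervalIntegral_inner_primitive {d : ℕ} {u w U W : ℝ → Vec d} {a b : Vec d} {T : ℝ}
    (hT : 0 ≤ T) (hu : IntervalIntegrable u volume 0 T) (hw : IntervalIntegrable w volume 0 T)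
    (hU : ∀ t ∈ Icc 0 T, U t = a + ∫ s in (0 : ℝ)..t, u s)
    (hW : ∀ t ∈ Icc 0 T, W t = b + ∫ s in (0 : ℝ)..t, w s) :
    IntervalIntegrable (fun t => inner ℝ (u t) (W t) + inner ℝ (U t) (w t)) volume 0 T ∧
    ∫ t in (0 : ℝ)..T, (inner ℝ (u t) (W t) + inner ℝ (U t) (w t)) =
      inner ℝ (U T) (W T) - inner ℝ (U 0) (W 0) := by
  have hcomp : ∀ {k : ℝ → Vec d}, IntervalIntegrable k volume 0 T → ∀ i,
      IntervalIntegrable (fun t => k t i) volume 0 T := fun hk i =>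
    ⟨(EuclideanSpace.proj (𝕜 := ℝ) i).integrable_comp hk.1,
      (EuclideanSpace.proj (𝕜 := ℝ) i).integrable_comp hk.2⟩
  have hprim : ∀ {k K : ℝ → Vec d} {r : Vec d}, IntervalIntegrable k volume 0 T →
      (∀ t ∈ Icc 0 T, K t = r + ∫ s in (0 : ℝ)..t, k s) → ∀ i, ∀ t ∈ Icc 0 T,
      K t i = r i + ∫ s in (0 : ℝ)..t, k s i := by
    intro k K r hk hK i t ht
    have hsub : IntervalIntegrable k volume 0 t :=
      hk.mono_set (by rw [uIcc_of_le ht.1, uIcc_of_le hT]; exact Icc_subset_Icc_right ht.2)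
    have := (EuclideanSpace.proj (𝕜 := ℝ) i).intervalIntegral_comp_comm hsub
    rw [hK t ht]
    simpa using this.symm
  have hcont : ∀ {k K : ℝ → ℝ} {r : ℝ}, IntervalIntegrable k volume 0 T →
      (∀ t ∈ Icc 0 T, K t = r + ∫ s in (0 : ℝ)..t, k s) → ContinuousOn K (uIcc 0 T) := by
    intro k K r hk hK
    have h1 := intervalIntegral.continuousOn_primitive_interval
      (intervalIntegrable_iff_integrableOn_Icc_of_le hT |>.1 hk |>.mono_set
        (by rw [uIcc_of_le hT]))
    refine (continuousOn_const.add h1).congr fun t ht => hK t (by rwa [uIcc_of_le hT] at ht)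
  have hsum : ∀ t, inner ℝ (u t) (W t) + inner ℝ (U t) (w t) =
      ∑ i, (u t i * W t i + U t i * w t i) := by
    intro t
    simp only [PiLp.inner_apply, RCLike.inner_apply, conj_trivial, Finset.sum_add_distrib]
    simp only [mul_comm]
  have hint : ∀ i, IntervalIntegrable (fun t => u t i * W t i + U t i * w t i) volume 0 T :=
    fun i => ((hcomp hu i).mul_continuousOn (hcont (hcomp hw i) (hprim hw hW i))).add
      ((hcomp hw i).continuousOn_mul (hcont (hcomp hu i) (hprim hu hU i)))
  simp_rw [hsum]
  constructor
  · simpa [Finset.sum_fn] using IntervalIntegrable.sum Finset.univ fun i _ => hint i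
  · rw [intervalIntegral.integral_finsetSum fun i _ => hint i]
    simp_rw [fun i => intervalIntegral_mul_primitive hT (hcomp hu i) (hcomp hw i)
      (hprim hu hU i) (hprim hw hW i)]
    simp only [PiLp.inner_apply, RCLike.inner_apply, conj_trivial, Finset.sum_sub_distrib]
    simp only [mul_comm]

/-- A finite convex function on a finite-dimensional space has a subgradient at every point:
its strict epigraph is open and convex, and a hyperplane that separates it from a point of the
graph cannot be vertical. -/
theorem ConvexOn.exists_subgradient {F : Type*} [NormedAddCommGroup F] [InnerProductSpace ℝ F]
    [FiniteDimensional ℝ F] {V : F → ℝ} (hV : ConvexOn ℝ univ V) (x : F) :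
    ∃ q : F, ∀ y, V x + inner ℝ q (y - x) ≤ V y := by
  have hcont : Continuous V := hV.locallyLipschitz.continuous
  have hconv := hV.convex_strict_epigraph
  have hopen : IsOpen {p : F × ℝ | p.1 ∈ (univ : Set F) ∧ V p.1 < p.2} := by
    simp only [mem_univ, true_and]
    exact isOpen_lt (hcont.comp continuous_fst) continuous_snd
  obtain ⟨f, hf⟩ := geometric_hahn_banach_open_point hconv hopen (x := (x, V x)) (by simp)
  have hsplit : ∀ (y : F) (r : ℝ), f (y, r) = f (y, 0) + r * f (0, 1) := by
    intro y r
    have : ((y, r) : F × ℝ) = (y, 0) + r • (0, 1) := by simp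
    rw [this, map_add, map_smul, smul_eq_mul]
  have hneg : f (0, 1) < 0 := by
    have := hf (x, V x + 1) ⟨mem_univ _, by simp⟩
    rw [hsplit x (V x + 1), hsplit x (V x)] at this
    linarith
  set ℓ : F →L[ℝ] ℝ := (-(f (0, 1))⁻¹) • f.comp (ContinuousLinearMap.inl ℝ F ℝ)
  refine ⟨(InnerProductSpace.toDual ℝ F).symm ℓ, fun y => ?_⟩
  rw [InnerProductSpace.toDual_symm_apply]
  have hle : ∀ r, V y < r → f (y, 0) + r * f (0, 1) < f (x, 0) + V x * f (0, 1) := by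
    intro r hr
    have := hf (y, r) ⟨mem_univ _, hr⟩
    rwa [hsplit y r, hsplit x (V x)] at this
  have hle' : f (y, 0) + V y * f (0, 1) ≤ f (x, 0) + V x * f (0, 1) := by
    by_contra! hlt
    set δ := f (y, 0) + V y * f (0, 1) - (f (x, 0) + V x * f (0, 1))
    have hδ : 0 < δ := sub_pos.2 hlt
    have h1 := hle (V y + δ / (-f (0, 1))) (by
      have : 0 < δ / (-f (0, 1)) := div_pos hδ (neg_pos.2 hneg)
      linarith)
    have h2 : δ / (-f (0, 1)) * f (0, 1) = -δ := by
      have := hneg.ne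
      field_simp
    rw [add_mul, h2] at h1
    simp only [δ] at h1
    linarith
  have hℓ : ℓ (y - x) = -(f (0, 1))⁻¹ * (f (y, 0) - f (x, 0)) := by
    simp [ℓ, ← map_sub]
  have hinv : -(f (0, 1))⁻¹ * (-f (0, 1)) = 1 := by
    have := hneg.ne
    field_simp
  have hp : 0 ≤ -(f (0, 1))⁻¹ := by simpa using hneg.le
  rw [hℓ]
  have := mul_le_mul_of_nonneg_left (show f (y, 0) - f (x, 0) ≤ (V y - V x) * (-f (0, 1)) by
    linarith) hp
  have e : -(f (0, 1))⁻¹ * ((V y - V x) * -f (0, 1)) = V y - V x := by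
    rw [mul_left_comm, hinv, mul_one]
  linarith

end Generic

/-! ### Curves and their action -/

/-- Lebesgue measure on the time interval `[0, T]`. -/
noncomputable abbrev timeMeasure (T : ℝ) : Measure ℝ := volume.restrict (Icc 0 T)

/-- The curve that starts at `y` and has velocity `v`. -/
noncomputable def curve {d : ℕ} (y : Vec d) (v : ℝ → Vec d) (t : ℝ) : Vec d :=
  y + ∫ s in (0 : ℝ)..t, v s

section Curve

variable {d : ℕ} {T : ℝ}

theorem intervalIntegrable_of_memLp (hT : 0 ≤ T) {v : ℝ → Vec d}
    (hv : MemLp v 2 (timeMeasure T)) : IntervalIntegrable v volume 0 T :=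
  (intervalIntegrable_iff_integrableOn_Icc_of_le hT).2 (hv.integrable one_le_two)

theorem intervalIntegrable_of_mem_Icc {v : ℝ → Vec d} (hv : IntervalIntegrable v volume 0 T)
    {t : ℝ} (ht : t ∈ Icc 0 T) : IntervalIntegrable v volume 0 t :=
  hv.mono_set (by
    rw [uIcc_of_le ht.1, uIcc_of_le (ht.1.trans ht.2)]; exact Icc_subset_Icc_right ht.2)

theorem continuousOn_curve (hT : 0 ≤ T) (y : Vec d) {v : ℝ → Vec d}
    (hv : IntervalIntegrable v volume 0 T) : ContinuousOn (curve y v) (Icc 0 T) := by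
  have h := intervalIntegral.continuousOn_primitive_interval
    ((intervalIntegrable_iff_integrableOn_Icc_of_le hT).1 hv |>.mono_set (by rw [uIcc_of_le hT]))
  rw [uIcc_of_le hT] at h
  exact continuousOn_const.add h

theorem curve_congr_ae (y : Vec d) {v w : ℝ → Vec d} (h : v =ᵐ[timeMeasure T] w) {t : ℝ}
    (ht : t ∈ Icc 0 T) : curve y v t = curve y w t := by
  unfold curve
  congr 1
  refine intervalIntegral.integral_congr_ae ?_
  filter_upwards [(ae_restrict_iff' measurableSet_Icc).1 h] with s hs hs'
  rw [uIoc_of_le ht.1] at hs'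
  exact hs ⟨hs'.1.le, hs'.2.trans ht.2⟩

theorem curve_combo (y₀ y₁ : Vec d) {v₀ v₁ : ℝ → Vec d}
    (h₀ : IntervalIntegrable v₀ volume 0 T) (h₁ : IntervalIntegrable v₁ volume 0 T) (θ : ℝ)
    {t : ℝ} (ht : t ∈ Icc 0 T) :
    curve (y₀ + θ • (y₁ - y₀)) (fun s => v₀ s + θ • (v₁ s - v₀ s)) t =
      curve y₀ v₀ t + θ • (curve y₁ v₁ t - curve y₀ v₀ t) := by
  have i₀ := intervalIntegrable_of_mem_Icc h₀ ht
  have i₁ := intervalIntegrable_of_mem_Icc h₁ ht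
  unfold curve
  have i₂ : IntervalIntegrable (fun s => θ • (v₁ s - v₀ s)) volume 0 t := (i₁.sub i₀).smul θ
  rw [intervalIntegral.integral_add i₀ i₂, intervalIntegral.integral_smul,
    intervalIntegral.integral_sub i₁ i₀]
  module

theorem curve_add_sub (y₀ y₁ : Vec d) {v₀ v₁ : ℝ → Vec d}
    (h₀ : IntervalIntegrable v₀ volume 0 T) (h₁ : IntervalIntegrable v₁ volume 0 T)
    {t : ℝ} (ht : t ∈ Icc 0 T) :
    curve (y₁ - y₀) (fun s => v₁ s - v₀ s) t = curve y₁ v₁ t - curve y₀ v₀ t := by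
  have i₀ := intervalIntegrable_of_mem_Icc h₀ ht
  have i₁ := intervalIntegrable_of_mem_Icc h₁ ht
  unfold curve
  rw [intervalIntegral.integral_sub i₁ i₀]
  module

theorem norm_curve_sub_le (y₀ y₁ : Vec d) {v₀ v₁ : ℝ → Vec d}
    (h₀ : MemLp v₀ 2 (timeMeasure T)) (h₁ : MemLp v₁ 2 (timeMeasure T)) {t : ℝ}
    (ht : t ∈ Icc 0 T) :
    ‖curve y₁ v₁ t - curve y₀ v₀ t‖ ≤
      ‖y₁ - y₀‖ + √(T * ∫ s in Icc 0 T, ‖v₁ s - v₀ s‖ ^ 2) := by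
  have hT : 0 ≤ T := ht.1.trans ht.2
  rw [← curve_add_sub y₀ y₁ (intervalIntegrable_of_memLp hT h₀)
    (intervalIntegrable_of_memLp hT h₁) ht]
  refine (norm_add_le _ _).trans (add_le_add_right ?_ _)
  have hd : MemLp (fun s => v₁ s - v₀ s) 2 (timeMeasure T) := h₁.sub h₀
  have hi : IntegrableOn (fun s => ‖v₁ s - v₀ s‖) (Icc 0 T) := (hd.integrable one_le_two).norm
  calc ‖∫ s in (0 : ℝ)..t, (v₁ s - v₀ s)‖ ≤ ∫ s in (0 : ℝ)..t, ‖v₁ s - v₀ s‖ :=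
        intervalIntegral.norm_integral_le_integral_norm ht.1
    _ = ∫ s in Ioc 0 t, ‖v₁ s - v₀ s‖ := intervalIntegral.integral_of_le ht.1
    _ ≤ ∫ s in Icc 0 T, ‖v₁ s - v₀ s‖ :=
        setIntegral_mono_set hi (ae_of_all _ fun _ => norm_nonneg _)
          (Filter.Eventually.of_forall fun s hs => ⟨hs.1.le, hs.2.trans ht.2⟩)
    _ ≤ √(T * ∫ s in Icc 0 T, ‖v₁ s - v₀ s‖ ^ 2) := by
        apply Real.le_sqrt_of_sq_le
        simpa [measureReal_def, hT] using sq_integral_le_measureReal_mul hd.norm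

theorem norm_toLp_sub_sq {v₀ v₁ : ℝ → Vec d}
    (h₀ : MemLp v₀ 2 (timeMeasure T)) (h₁ : MemLp v₁ 2 (timeMeasure T)) :
    ‖h₁.toLp v₁ - h₀.toLp v₀‖ ^ 2 = ∫ s in Icc 0 T, ‖v₁ s - v₀ s‖ ^ 2 := by
  rw [← MemLp.toLp_sub, ← real_inner_self_eq_norm_sq, L2.inner_def]
  refine integral_congr_ae ?_
  filter_upwards [(h₁.sub h₀).coeFn_toLp] with s hs
  rw [hs, real_inner_self_eq_norm_sq, Pi.sub_apply]

end Curve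

section Action

variable {d : ℕ} {L : Vec d → Vec d → Vec d → ℝ} {c M : ℝ} {g : Vec d → ℝ} {T : ℝ}
  {Q : ℝ → Vec d}

/-- The curve that starts at `y` with velocity `v` has square integrable velocity and finite
action under the control `Q`. -/
structure Admissible (L : Vec d → Vec d → Vec d → ℝ) (c T : ℝ) (Q : ℝ → Vec d)
    (y : Vec d) (v : ℝ → Vec d) : Prop where
  memLp : MemLp v 2 (timeMeasure T)
  integrable : Integrable (fun t => coerciveLagrangian L c (curve y v t) (v t) (Q t))
    (timeMeasure T)

/-- The action of the curve that starts at `y` with velocity `v`, terminal cost included. It is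
meaningful for admissible pairs only. -/
noncomputable def action (L : Vec d → Vec d → Vec d → ℝ) (c : ℝ) (g : Vec d → ℝ) (T : ℝ)
    (Q : ℝ → Vec d) (y : Vec d) (v : ℝ → Vec d) : ℝ :=
  (∫ t in Icc 0 T, coerciveLagrangian L c (curve y v t) (v t) (Q t)) + g (curve y v T)

theorem aestronglyMeasurable_comp_state {F : Type*} [TopologicalSpace F]
    [TopologicalSpace.PseudoMetrizableSpace F] {Φ : Vec d × Vec d × Vec d → F}
    (hΦ : Continuous Φ) (hT : 0 ≤ T) (hQ : AEStronglyMeasurable Q (timeMeasure T)) (y : Vec d)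
    {v : ℝ → Vec d} (hv : IntervalIntegrable v volume 0 T) :
    AEStronglyMeasurable (fun t => Φ (curve y v t, v t, Q t)) (timeMeasure T) := by
  have h1 := (continuousOn_curve hT y hv).aestronglyMeasurable (μ := volume) measurableSet_Icc
  have h2 := ((intervalIntegrable_iff_integrableOn_Icc_of_le hT).1 hv).aestronglyMeasurable
  exact hΦ.comp_aestronglyMeasurable (h1.prodMk (h2.prodMk hQ))

theorem Admissible.of_bounded (hL : LagrangianAssumption L c M) (hT : 0 ≤ T)
    (hQ : MemLp Q 2 (timeMeasure T)) (y : Vec d) {v : ℝ → Vec d}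
    (hv : AEStronglyMeasurable v (timeMeasure T)) {R : ℝ} (hR : ∀ t, ‖v t‖ ≤ R) :
    Admissible L c T Q y v := by
  have hm : MemLp v 2 (timeMeasure T) := MemLp.of_bound hv R (ae_of_all _ hR)
  have hi := intervalIntegrable_of_memLp hT hm
  refine ⟨hm, ?_⟩
  obtain ⟨S, hS⟩ := isCompact_Icc.exists_bound_of_continuousOn (continuousOn_curve hT y hi)
  obtain ⟨C, hC⟩ := hL.exists_coerciveLagrangian_le (max R S)
  refine Integrable.mono' (g := fun t => C * (1 + ‖Q t‖ ^ 2))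
    (((integrable_const 1).add hQ.norm.integrable_sq).const_mul C)
    (aestronglyMeasurable_comp_state hL.continuous_coerciveLagrangian hT
      hQ.aestronglyMeasurable y hi) ?_
  filter_upwards [ae_restrict_mem measurableSet_Icc] with t ht
  rw [Real.norm_of_nonneg (hL.coerciveLagrangian_nonneg _ _ _)]
  exact hC _ _ _ ((hS t ht).trans (le_max_right _ _)) ((hR t).trans (le_max_left _ _))

theorem Admissible.combo (hL : LagrangianAssumption L c M) (hT : 0 ≤ T)
    (hQ : MemLp Q 2 (timeMeasure T)) {y₀ y₁ : Vec d} {v₀ v₁ : ℝ → Vec d}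
    (h₀ : Admissible L c T Q y₀ v₀) (h₁ : Admissible L c T Q y₁ v₁) {θ : ℝ} (hθ : θ ∈ Icc 0 1) :
    Admissible L c T Q (y₀ + θ • (y₁ - y₀)) (fun s => v₀ s + θ • (v₁ s - v₀ s)) := by
  have hm : MemLp (fun s => v₀ s + θ • (v₁ s - v₀ s)) 2 (timeMeasure T) :=
    h₀.memLp.add ((h₁.memLp.sub h₀.memLp).const_smul θ)
  refine ⟨hm, Integrable.mono' ((h₀.integrable.const_mul (1 - θ)).add (h₁.integrable.const_mul θ))
    (aestronglyMeasurable_comp_state hL.continuous_coerciveLagrangian hT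
      hQ.aestronglyMeasurable _ (intervalIntegrable_of_memLp hT hm)) ?_⟩
  filter_upwards [ae_restrict_mem measurableSet_Icc] with t ht
  rw [Real.norm_of_nonneg (hL.coerciveLagrangian_nonneg _ _ _),
    curve_combo y₀ y₁ (intervalIntegrable_of_memLp hT h₀.memLp)
      (intervalIntegrable_of_memLp hT h₁.memLp) θ ht]
  refine le_trans (le_add_of_nonneg_right ?_)
    (hL.coerciveLagrangian_combo_le _ _ _ _ (Q t) hθ.1 hθ.2)
  have := hL.c_pos
  have := sub_nonneg.2 hθ.2
  have := hθ.1
  positivity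

/-- The action is strongly convex in the velocity. -/
theorem action_combo_le (hL : LagrangianAssumption L c M) (hg : ConvexOn ℝ univ g) (hT : 0 ≤ T)
    (hQ : MemLp Q 2 (timeMeasure T)) {y₀ y₁ : Vec d} {v₀ v₁ : ℝ → Vec d}
    (h₀ : Admissible L c T Q y₀ v₀) (h₁ : Admissible L c T Q y₁ v₁) {θ : ℝ} (hθ : θ ∈ Icc 0 1) :
    action L c g T Q (y₀ + θ • (y₁ - y₀)) (fun s => v₀ s + θ • (v₁ s - v₀ s)) +
      c / 2 * (θ * (1 - θ)) * ∫ t in Icc 0 T, ‖v₁ t - v₀ t‖ ^ 2 ≤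
      (1 - θ) * action L c g T Q y₀ v₀ + θ * action L c g T Q y₁ v₁ := by
  have hc := h₀.combo hL hT hQ h₁ hθ
  have i₀ := intervalIntegrable_of_memLp hT h₀.memLp
  have i₁ := intervalIntegrable_of_memLp hT h₁.memLp
  have hsq : Integrable (fun t => c / 2 * (θ * (1 - θ)) * ‖v₁ t - v₀ t‖ ^ 2) (timeMeasure T) :=
    (h₁.memLp.sub h₀.memLp).norm.integrable_sq.const_mul _
  have hint := integral_mono_ae (hc.integrable.add hsq)
    ((h₀.integrable.const_mul (1 - θ)).add (h₁.integrable.const_mul θ)) (by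
      filter_upwards [ae_restrict_mem measurableSet_Icc] with t ht
      simp only [Pi.add_apply]
      rw [curve_combo y₀ y₁ i₀ i₁ θ ht]
      refine le_trans ?_ (hL.coerciveLagrangian_combo_le _ _ _ _ (Q t) hθ.1 hθ.2)
      have := hL.c_pos
      have := sub_nonneg.2 hθ.2
      have := hθ.1
      gcongr
      exact le_add_of_nonneg_left (sq_nonneg _))
  rw [integral_add' hc.integrable hsq, integral_add' (h₀.integrable.const_mul _)
    (h₁.integrable.const_mul _), integral_const_mul, integral_const_mul, integral_const_mul] at hint
  have hend := hg.2 (mem_univ (curve y₀ v₀ T)) (mem_univ (curve y₁ v₁ T))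
    (sub_nonneg.2 hθ.2) hθ.1 (sub_add_cancel 1 θ)
  have e : (1 - θ) • curve y₀ v₀ T + θ • curve y₁ v₁ T =
      curve (y₀ + θ • (y₁ - y₀)) (fun s => v₀ s + θ • (v₁ s - v₀ s)) T := by
    rw [curve_combo y₀ y₁ i₀ i₁ θ ⟨hT, le_rfl⟩]; module
  rw [e, smul_eq_mul, smul_eq_mul] at hend
  unfold action
  linarith

theorem action_bddBelow (hL : LagrangianAssumption L c M) {q : Vec d} (hT : 0 ≤ T) (y : Vec d)
    (hq : ∀ x, g y + inner ℝ q (x - y) ≤ g x) :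
    ∃ m : ℝ, ∀ v, Admissible L c T Q y v → m ≤ action L c g T Q y v := by
  refine ⟨-(T * (‖q‖ ^ 2 / c)) + g y, fun v hv => ?_⟩
  have hc := hL.c_pos
  have hi := hv.memLp.integrable one_le_two
  have hend : g y + ∫ t in Icc 0 T, inner ℝ q (v t) ≤ g (curve y v T) := by
    have h := hq (curve y v T)
    have e : curve y v T - y = ∫ t in Icc 0 T, v t := by
      rw [curve, add_sub_cancel_left, intervalIntegral.integral_of_le hT,
        ← integral_Icc_eq_integral_Ioc]
    rwa [e, ← integral_inner hi] at h
  have hlow : ∫ t in Icc 0 T, -(‖q‖ ^ 2 / c) ≤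
      ∫ t in Icc 0 T, (coerciveLagrangian L c (curve y v t) (v t) (Q t) + inner ℝ q (v t)) := by
    refine integral_mono (integrable_const _) (hv.integrable.add (hi.const_inner q)) fun t => ?_
    have h1 := hL.le_coerciveLagrangian (curve y v t) (v t) (Q t)
    have h2 := neg_le_of_abs_le (abs_real_inner_le_norm q (v t))
    have e : c / 4 * ‖v t‖ ^ 2 + ‖q‖ ^ 2 / c - ‖q‖ * ‖v t‖ =
        (2 * ‖q‖ - c * ‖v t‖) ^ 2 / (4 * c) := by field_simp; ring
    have h3 : 0 ≤ (2 * ‖q‖ - c * ‖v t‖) ^ 2 / (4 * c) := by positivity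
    have h4 : 0 ≤ c / 4 * ‖curve y v t‖ ^ 2 := by positivity
    dsimp only
    linarith
  rw [integral_add hv.integrable (hi.const_inner q)] at hlow
  simp [measureReal_def, hT] at hlow
  unfold action
  linarith

end Action

/-! ### Minimizers of the action and the value function -/

section Minimizer

open Filter Topology

variable {d : ℕ} {L : Vec d → Vec d → Vec d → ℝ} {c M : ℝ} {g : Vec d → ℝ} {T : ℝ}
  {Q : ℝ → Vec d}

/-- The velocity `v` is admissible from `y` and minimizes the action among such velocities. -/
structure IsMinimizer (L : Vec d → Vec d → Vec d → ℝ) (c : ℝ) (g : Vec d → ℝ) (T : ℝ)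
    (Q : ℝ → Vec d) (y : Vec d) (v : ℝ → Vec d) : Prop where
  admissible : Admissible L c T Q y v
  le_action : ∀ w, Admissible L c T Q y w → action L c g T Q y v ≤ action L c g T Q y w

/-- Admissible velocities of nearly minimal action are close in `L²`; here `m` is a lower bound for
the action from the midpoint of the two starting points. -/
theorem integral_norm_sub_sq_le_of_le_action (hL : LagrangianAssumption L c M)
    (hg : ConvexOn ℝ univ g) (hT : 0 ≤ T) (hQ : MemLp Q 2 (timeMeasure T))
    {y₀ y₁ : Vec d} {v₀ v₁ : ℝ → Vec d}
    (h₀ : Admissible L c T Q y₀ v₀) (h₁ : Admissible L c T Q y₁ v₁) {m : ℝ}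
    (hm : ∀ w, Admissible L c T Q (y₀ + (1 / 2 : ℝ) • (y₁ - y₀)) w →
      m ≤ action L c g T Q (y₀ + (1 / 2 : ℝ) • (y₁ - y₀)) w) :
    c / 8 * ∫ t in Icc 0 T, ‖v₁ t - v₀ t‖ ^ 2 ≤
      (action L c g T Q y₀ v₀ + action L c g T Q y₁ v₁) / 2 - m := by
  have hθ : (1 / 2 : ℝ) ∈ Icc (0 : ℝ) 1 := by norm_num
  have h1 := action_combo_le hL hg hT hQ h₀ h₁ hθ
  have h2 := hm _ (h₀.combo hL hT hQ h₁ hθ)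
  norm_num at h1 h2
  linarith

theorem exists_isMinimizer (hL : LagrangianAssumption L c M) (hg : ConvexOn ℝ univ g)
    (hT : 0 ≤ T) (hQ : MemLp Q 2 (timeMeasure T)) (y : Vec d) :
    ∃ v, IsMinimizer L c g T Q y v := by
  have hc := hL.c_pos
  have hgc : Continuous g := hg.locallyLipschitz.continuous
  obtain ⟨q, hq⟩ := hg.exists_subgradient y
  obtain ⟨m₀, hm₀⟩ := action_bddBelow (Q := Q) hL hT y hq
  set S : Set ℝ := {a | ∃ w, Admissible L c T Q y w ∧ action L c g T Q y w = a}
  have hSne : S.Nonempty := ⟨_, 0, Admissible.of_bounded hL hT hQ y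
    aestronglyMeasurable_const (R := 0) (by simp), rfl⟩
  have hSb : BddBelow S := ⟨m₀, by rintro _ ⟨w, hw, rfl⟩; exact hm₀ w hw⟩
  set m := sInf S
  have hm : ∀ w, Admissible L c T Q y w → m ≤ action L c g T Q y w :=
    fun w hw => csInf_le hSb ⟨w, hw, rfl⟩
  have hseq : ∀ n : ℕ, ∃ w, Admissible L c T Q y w ∧
      action L c g T Q y w < m + 1 / ((n : ℝ) + 1) := by
    intro n
    obtain ⟨_, ⟨w, hw, rfl⟩, h⟩ := exists_lt_of_csInf_lt hSne
      (show sInf S < m + 1 / ((n : ℝ) + 1) from lt_add_of_pos_right _ (by positivity))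
    exact ⟨w, hw, h⟩
  choose w hw hwm using hseq
  -- The minimizing sequence is Cauchy in `L²` by strong convexity.
  set f : ℕ → Lp (Vec d) 2 (timeMeasure T) := fun n => (hw n).memLp.toLp (w n)
  have hdist : ∀ n k, ‖f k - f n‖ ^ 2 ≤ 8 / c * ((1 / ((n : ℝ) + 1) + 1 / ((k : ℝ) + 1)) / 2) := by
    intro n k
    rw [norm_toLp_sub_sq (hw n).memLp (hw k).memLp]
    have h := integral_norm_sub_sq_le_of_le_action hL hg hT hQ (hw n) (hw k) (m := m)
      (by simpa using hm)
    have h' : c / 8 * ∫ t in Icc 0 T, ‖w k t - w n t‖ ^ 2 ≤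
        (1 / ((n : ℝ) + 1) + 1 / ((k : ℝ) + 1)) / 2 := by
      linarith [hwm n, hwm k]
    have h'' := mul_le_mul_of_nonneg_left h' (show 0 ≤ 8 / c by positivity)
    rwa [← mul_assoc, show 8 / c * (c / 8) = 1 by field_simp, one_mul] at h''
  have hCauchy : CauchySeq f := by
    rw [Metric.cauchySeq_iff']
    intro ε hε
    obtain ⟨N, hN⟩ := exists_nat_one_div_lt (show 0 < c / 8 * ε ^ 2 by positivity)
    refine ⟨N, fun n hn => ?_⟩
    rw [dist_eq_norm]
    refine lt_of_pow_lt_pow_left₀ 2 hε.le ((hdist N n).trans_lt ?_)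
    have : 1 / ((n : ℝ) + 1) ≤ 1 / ((N : ℝ) + 1) := by gcongr
    calc 8 / c * ((1 / ((N : ℝ) + 1) + 1 / ((n : ℝ) + 1)) / 2)
        < 8 / c * (c / 8 * ε ^ 2) := by
          refine mul_lt_mul_of_pos_left ?_ (by positivity)
          linarith
      _ = ε ^ 2 := by field_simp
  obtain ⟨F, hF⟩ := cauchySeq_tendsto_of_complete hCauchy
  have hFm : MemLp F 2 (timeMeasure T) := Lp.memLp F
  obtain ⟨φ, hφ, hae⟩ := (tendstoInMeasure_of_tendsto_Lp hF).exists_seq_tendsto_ae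
  have hnorm : Tendsto (fun n => √(T * ∫ s in Icc 0 T, ‖w (φ n) s - F s‖ ^ 2)) atTop (𝓝 0) := by
    have h1 : Tendsto (fun n => ‖f (φ n) - F‖) atTop (𝓝 0) :=
      tendsto_iff_norm_sub_tendsto_zero.1 (hF.comp hφ.tendsto_atTop)
    have h2 : Tendsto (fun n => √(T * ‖f (φ n) - F‖ ^ 2)) atTop (𝓝 (√(T * 0 ^ 2))) :=
      ((h1.pow 2).const_mul T).sqrt
    simp only [ne_eq, OfNat.ofNat_ne_zero, not_false_eq_true, zero_pow, mul_zero,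
      Real.sqrt_zero] at h2
    refine h2.congr fun n => ?_
    have := norm_toLp_sub_sq hFm (hw (φ n)).memLp
    rw [Lp.toLp_coeFn] at this
    rw [← this]
  have hcurve : ∀ t ∈ Icc 0 T, Tendsto (fun n => curve y (w (φ n)) t) atTop (𝓝 (curve y F t)) := by
    intro t ht
    rw [tendsto_iff_norm_sub_tendsto_zero]
    refine squeeze_zero (fun _ => norm_nonneg _) (fun n => ?_) hnorm
    simpa using norm_curve_sub_le y y hFm (hw (φ n)).memLp ht
  have hTmem : T ∈ Icc 0 T := ⟨hT, le_rfl⟩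
  have hend : Tendsto (fun n => g (curve y (w (φ n)) T)) atTop (𝓝 (g (curve y F T))) :=
    (hgc.tendsto _).comp (hcurve T hTmem)
  have hlim := integrable_and_integral_le_of_tendsto (μ := timeMeasure T)
    (F := fun n t => coerciveLagrangian L c (curve y (w (φ n)) t) (w (φ n) t) (Q t))
    (f := fun t => coerciveLagrangian L c (curve y F t) (F t) (Q t))
    (B := fun n => m + 1 / ((φ n : ℝ) + 1) - g (curve y (w (φ n)) T))
    (b := m + 0 - g (curve y F T))
    (fun n => (hw (φ n)).integrable)
    (fun n => ae_of_all _ fun t => hL.coerciveLagrangian_nonneg _ _ _)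
    (by
      filter_upwards [hae, ae_restrict_mem measurableSet_Icc,
        ae_all_iff.2 fun n => (hw (φ n)).memLp.coeFn_toLp] with t h1 ht h2
      have h1' : Tendsto (fun n => w (φ n) t) atTop (𝓝 (F t)) := h1.congr fun n => h2 n
      exact (hL.continuous_coerciveLagrangian.tendsto (curve y F t, F t, Q t)).comp
        ((hcurve t ht).prodMk_nhds (h1'.prodMk_nhds tendsto_const_nhds)))
    (fun n => by
      have := (hwm (φ n)).le
      unfold action at this
      linarith)
    ((tendsto_const_nhds.add
      (tendsto_one_div_add_atTop_nhds_zero_nat.comp hφ.tendsto_atTop)).sub hend)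
  refine ⟨F, ⟨hFm, hlim.1⟩, fun u hu => le_trans ?_ (hm u hu)⟩
  unfold action
  linarith [hlim.2]

/-- The value function: the minimal action of the curves that start at `y`. -/
noncomputable def valueFunction (L : Vec d → Vec d → Vec d → ℝ) (c : ℝ) (g : Vec d → ℝ) (T : ℝ)
    (Q : ℝ → Vec d) (y : Vec d) : ℝ :=
  sInf {a | ∃ w, Admissible L c T Q y w ∧ action L c g T Q y w = a}

theorem IsMinimizer.valueFunction_eq {y : Vec d} {v : ℝ → Vec d}
    (h : IsMinimizer L c g T Q y v) : valueFunction L c g T Q y = action L c g T Q y v :=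
  IsLeast.csInf_eq ⟨⟨v, h.admissible, rfl⟩, by rintro _ ⟨w, hw, rfl⟩; exact h.le_action w hw⟩

theorem valueFunction_le (hL : LagrangianAssumption L c M) (hg : ConvexOn ℝ univ g)
    (hT : 0 ≤ T) (hQ : MemLp Q 2 (timeMeasure T)) {y : Vec d} {w : ℝ → Vec d}
    (hw : Admissible L c T Q y w) : valueFunction L c g T Q y ≤ action L c g T Q y w := by
  obtain ⟨v, hv⟩ := exists_isMinimizer hL hg hT hQ y
  exact hv.valueFunction_eq.trans_le (hv.le_action w hw)

theorem convexOn_valueFunction (hL : LagrangianAssumption L c M) (hg : ConvexOn ℝ univ g)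
    (hT : 0 ≤ T) (hQ : MemLp Q 2 (timeMeasure T)) :
    ConvexOn ℝ univ (valueFunction L c g T Q) := by
  refine ⟨convex_univ, fun y₀ _ y₁ _ a b ha hb hab => ?_⟩
  obtain ⟨v₀, hv₀⟩ := exists_isMinimizer hL hg hT hQ y₀
  obtain ⟨v₁, hv₁⟩ := exists_isMinimizer hL hg hT hQ y₁
  have hb' : b ∈ Icc (0 : ℝ) 1 := ⟨hb, by linarith⟩
  obtain rfl : a = 1 - b := by linarith
  have h1 := action_combo_le hL hg hT hQ hv₀.admissible hv₁.admissible hb'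
  have h2 := valueFunction_le hL hg hT hQ (hv₀.admissible.combo hL hT hQ hv₁.admissible hb')
  have e : (1 - b) • y₀ + b • y₁ = y₀ + b • (y₁ - y₀) := by module
  have h3 : 0 ≤ c / 2 * (b * (1 - b)) * ∫ t in Icc 0 T, ‖v₁ t - v₀ t‖ ^ 2 := by
    have := hL.c_pos
    have : 0 ≤ ∫ t in Icc 0 T, ‖v₁ t - v₀ t‖ ^ 2 := integral_nonneg fun t => sq_nonneg _
    positivity
  rw [e, hv₀.valueFunction_eq, hv₁.valueFunction_eq, smul_eq_mul, smul_eq_mul]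
  linarith

/-- The modulus of continuity of the minimizers in the starting point: by strong convexity of the
action it is governed by the convexity gap of the value function. -/
theorem IsMinimizer.integral_norm_sub_sq_le (hL : LagrangianAssumption L c M)
    (hg : ConvexOn ℝ univ g) (hT : 0 ≤ T) (hQ : MemLp Q 2 (timeMeasure T))
    {y₀ y₁ : Vec d} {v₀ v₁ : ℝ → Vec d}
    (h₀ : IsMinimizer L c g T Q y₀ v₀) (h₁ : IsMinimizer L c g T Q y₁ v₁) :
    c / 8 * ∫ t in Icc 0 T, ‖v₁ t - v₀ t‖ ^ 2 ≤
      (valueFunction L c g T Q y₀ + valueFunction L c g T Q y₁) / 2 -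
        valueFunction L c g T Q (y₀ + (1 / 2 : ℝ) • (y₁ - y₀)) := by
  rw [h₀.valueFunction_eq, h₁.valueFunction_eq]
  exact integral_norm_sub_sq_le_of_le_action hL hg hT hQ h₀.admissible h₁.admissible
    fun w hw => valueFunction_le hL hg hT hQ hw

end Minimizer

/-! ### Minimizers solve the Euler–Lagrange system -/

section FirstVariation

open Filter Topology

variable {d : ℕ} {L : Vec d → Vec d → Vec d → ℝ} {c M : ℝ} {g : Vec d → ℝ} {T : ℝ}
  {Q : ℝ → Vec d}

/-- The first variation at a minimizer, in the direction of another curve of finite action. Moving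
the starting point is compensated by a subgradient `q` of the value function. The difference
quotients decrease to the first variation by convexity, so Fatou's lemma yields
its integrability along with the inequality, although the forces need not be square integrable. -/
theorem IsMinimizer.integrable_variation (hL : LagrangianAssumption L c M)
    (hgd : Differentiable ℝ g) (hg : ConvexOn ℝ univ g) (hT : 0 ≤ T)
    (hQ : MemLp Q 2 (timeMeasure T)) {y y' q : Vec d} {v v' : ℝ → Vec d}
    (hv : IsMinimizer L c g T Q y v) (hv' : Admissible L c T Q y' v')
    (hq : ∀ z, valueFunction L c g T Q y + inner ℝ q (z - y) ≤ valueFunction L c g T Q z) :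
    Integrable (fun t => inner ℝ (gradX L (curve y v t) (v t) (Q t)) (curve y' v' t - curve y v t) +
      inner ℝ (gradV L (curve y v t) (v t) (Q t)) (v' t - v t)) (timeMeasure T) ∧
    0 ≤ (∫ t in Icc 0 T,
      (inner ℝ (gradX L (curve y v t) (v t) (Q t)) (curve y' v' t - curve y v t) +
        inner ℝ (gradV L (curve y v t) (v t) (Q t)) (v' t - v t))) +
      inner ℝ (gradient g (curve y v T)) (curve y' v' T - curve y v T) - inner ℝ q (y' - y) := by
  have hva := hv.admissible
  have i₀ := intervalIntegrable_of_memLp hT hva.memLp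
  have i₁ := intervalIntegrable_of_memLp hT hv'.memLp
  set φ : ℝ → ℝ := fun t =>
    inner ℝ (gradX L (curve y v t) (v t) (Q t)) (curve y' v' t - curve y v t) +
      inner ℝ (gradV L (curve y v t) (v t) (Q t)) (v' t - v t)
  set θ : ℕ → ℝ := fun n => 1 / ((n : ℝ) + 1)
  have hθ0 : ∀ n, 0 < θ n := fun n => by positivity
  have hθ1 : ∀ n, θ n ∈ Icc (0 : ℝ) 1 := fun n =>
    ⟨(hθ0 n).le, by rw [div_le_one (by positivity)]; linarith [n.cast_nonneg (α := ℝ)]⟩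
  have hθlim : Tendsto θ atTop (𝓝[≠] 0) := tendsto_nhdsWithin_iff.2
    ⟨tendsto_one_div_add_atTop_nhds_zero_nat, Eventually.of_forall fun n => (hθ0 n).ne'⟩
  set N₀ : ℝ → ℝ := fun t => coerciveLagrangian L c (curve y v t) (v t) (Q t)
  set N₁ : ℝ → ℝ := fun t => coerciveLagrangian L c (curve y' v' t) (v' t) (Q t)
  set Nθ : ℕ → ℝ → ℝ := fun n t => coerciveLagrangian L c
    (curve (y + θ n • (y' - y)) (fun s => v s + θ n • (v' s - v s)) t)
    (v t + θ n • (v' t - v t)) (Q t)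
  have hNθ : ∀ n, Integrable (Nθ n) (timeMeasure T) :=
    fun n => (hva.combo hL hT hQ hv' (hθ1 n)).integrable
  have hN₀ : Integrable N₀ (timeMeasure T) := hva.integrable
  have hN₁ : Integrable N₁ (timeMeasure T) := hv'.integrable
  have hF : ∀ n, Integrable (fun t => N₁ t - N₀ t - (θ n)⁻¹ * (Nθ n t - N₀ t)) (timeMeasure T) :=
    fun n => (hN₁.sub hN₀).sub (((hNθ n).sub hN₀).const_mul _)
  have hlim := integrable_and_integral_le_of_tendsto (μ := timeMeasure T) hF
    (f := fun t => N₁ t - N₀ t - φ t)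
    (B := fun n => (∫ t in Icc 0 T, N₁ t) - (∫ t in Icc 0 T, N₀ t) +
      (θ n)⁻¹ * (g (curve y v T + θ n • (curve y' v' T - curve y v T)) - g (curve y v T)) -
        inner ℝ q (y' - y))
    (b := (∫ t in Icc 0 T, N₁ t) - (∫ t in Icc 0 T, N₀ t) +
      inner ℝ (gradient g (curve y v T)) (curve y' v' T - curve y v T) - inner ℝ q (y' - y))
    (fun n => by
      filter_upwards [ae_restrict_mem measurableSet_Icc] with t ht
      have h := hL.coerciveLagrangian_combo_le (curve y v t) (v t) (curve y' v' t) (v' t) (Q t)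
        (hθ1 n).1 (hθ1 n).2
      rw [← curve_combo y y' i₀ i₁ (θ n) ht] at h
      have hnn : 0 ≤ c / 2 * (θ n * (1 - θ n)) *
          (‖curve y' v' t - curve y v t‖ ^ 2 + ‖v' t - v t‖ ^ 2) := by
        have := hL.c_pos
        have := sub_nonneg.2 (hθ1 n).2
        have := hθ0 n
        positivity
      have h' : Nθ n t - N₀ t ≤ θ n * (N₁ t - N₀ t) := by
        simp only [Nθ, N₀, N₁]; linarith
      have h'' := mul_le_mul_of_nonneg_left h' (inv_nonneg.2 (hθ0 n).le)
      rw [inv_mul_cancel_left₀ (hθ0 n).ne'] at h''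
      simpa using h'')
    (by
      filter_upwards [ae_restrict_mem measurableSet_Icc] with t ht
      have h := (hasDerivAt_iff_tendsto_slope_zero.1 (hL.hasDerivAt_coerciveLagrangian
        (curve y v t) (v t) (Q t) (curve y' v' t - curve y v t) (v' t - v t))).comp hθlim
      simp only [zero_add, zero_smul, add_zero, smul_eq_mul] at h
      refine tendsto_const_nhds.sub (h.congr fun n => ?_)
      simp only [Function.comp_apply, Nθ, N₀]
      rw [curve_combo y y' i₀ i₁ (θ n) ht])
    (fun n => by
      have h := hq (y + θ n • (y' - y))
      have h1 := valueFunction_le hL hg hT hQ (hva.combo hL hT hQ hv' (hθ1 n))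
      rw [hv.valueFunction_eq, add_sub_cancel_left, inner_smul_right] at h
      have h2 := h.trans h1
      unfold action at h2
      have h3 : θ n * inner ℝ q (y' - y) - (g (curve y v T + θ n • (curve y' v' T - curve y v T)) -
          g (curve y v T)) ≤ (∫ t in Icc 0 T, Nθ n t) - ∫ t in Icc 0 T, N₀ t := by
        rw [curve_combo y y' i₀ i₁ (θ n) ⟨hT, le_rfl⟩] at h2
        simp only [Nθ, N₀]
        linarith
      have h4 := mul_le_mul_of_nonneg_left h3 (inv_nonneg.2 (hθ0 n).le)
      rw [mul_sub, inv_mul_cancel_left₀ (hθ0 n).ne'] at h4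
      rw [integral_sub (hN₁.sub' hN₀) (((hNθ n).sub' hN₀).const_mul _), integral_sub hN₁ hN₀,
        integral_const_mul, integral_sub (hNθ n) hN₀]
      linarith)
    (by
      refine (tendsto_const_nhds.add ?_).sub tendsto_const_nhds
      have h1 : HasDerivAt (fun r : ℝ => curve y v T + r • (curve y' v' T - curve y v T))
          (curve y' v' T - curve y v T) 0 := by
        simpa using ((hasDerivAt_id (0 : ℝ)).smul_const _).const_add (curve y v T)
      have h2 := (hgd (curve y v T + (0 : ℝ) • (curve y' v' T - curve y v T))
        ).hasFDerivAt.comp_hasDerivAt (0 : ℝ) h1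
      have h3 := (hasDerivAt_iff_tendsto_slope_zero.1 h2).comp hθlim
      simp only [zero_smul, add_zero, Function.comp_apply, zero_add, smul_eq_mul] at h3
      rw [inner_gradient_eq_fderiv]
      exact h3)
  have hφ : Integrable φ (timeMeasure T) := by
    refine ((hN₁.sub' hN₀).sub' hlim.1).congr (ae_of_all _ fun t => ?_)
    simp
  refine ⟨hφ, ?_⟩
  have h := hlim.2
  rw [integral_sub (hN₁.sub' hN₀) hφ, integral_sub hN₁ hN₀] at h
  linarith

/-- The Euler–Lagrange equation in weak form. Among the competitors are all Lipschitz curves, and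
these form a vector space, so the first variation vanishes. -/
theorem IsMinimizer.weak_eulerLagrange (hL : LagrangianAssumption L c M)
    (hgd : Differentiable ℝ g) (hg : ConvexOn ℝ univ g) (hT : 0 ≤ T)
    (hQ : MemLp Q 2 (timeMeasure T)) {y q : Vec d} {v : ℝ → Vec d}
    (hv : IsMinimizer L c g T Q y v)
    (hq : ∀ z, valueFunction L c g T Q y + inner ℝ q (z - y) ≤ valueFunction L c g T Q z)
    (η : Vec d) {w : ℝ → Vec d} (hw : AEStronglyMeasurable w (timeMeasure T)) {R : ℝ}
    (hR : ∀ t, ‖w t‖ ≤ R) :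
    Integrable (fun t => inner ℝ (gradX L (curve y v t) (v t) (Q t)) (curve η w t) +
      inner ℝ (gradV L (curve y v t) (v t) (Q t)) (w t)) (timeMeasure T) ∧
    (∫ t in Icc 0 T, (inner ℝ (gradX L (curve y v t) (v t) (Q t)) (curve η w t) +
        inner ℝ (gradV L (curve y v t) (v t) (Q t)) (w t))) +
      inner ℝ (gradient g (curve y v T)) (curve η w T) - inner ℝ q η = 0 := by
  set f : ℝ → Vec d := fun t => gradX L (curve y v t) (v t) (Q t)
  set π : ℝ → Vec d := fun t => gradV L (curve y v t) (v t) (Q t)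
  have hadm : ∀ s : ℝ, Admissible L c T Q (y + s • η) (fun t => s • w t) := fun s =>
    Admissible.of_bounded hL hT hQ _ (hw.const_smul s) (R := |s| * R) fun t => by
      rw [norm_smul, Real.norm_eq_abs]
      exact mul_le_mul_of_nonneg_left (hR t) (abs_nonneg s)
  have hvar : ∀ s : ℝ, Integrable (fun t =>
      inner ℝ (f t) (curve (y + s • η) (fun t => s • w t) t - curve y v t) +
        inner ℝ (π t) (s • w t - v t)) (timeMeasure T) ∧
      0 ≤ (∫ t in Icc 0 T,
        (inner ℝ (f t) (curve (y + s • η) (fun t => s • w t) t - curve y v t) +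
          inner ℝ (π t) (s • w t - v t))) +
        inner ℝ (gradient g (curve y v T))
          (curve (y + s • η) (fun t => s • w t) T - curve y v T) -
        inner ℝ q (y + s • η - y) :=
    fun s => hv.integrable_variation hL hgd hg hT hQ (hadm s) hq
  have hcurve : ∀ s t : ℝ, curve (y + s • η) (fun t => s • w t) t = y + s • curve η w t := by
    intro s t
    unfold curve
    rw [intervalIntegral.integral_smul]
    module
  have hexp : ∀ s t : ℝ,
      inner ℝ (f t) (curve (y + s • η) (fun t => s • w t) t - curve y v t) +
        inner ℝ (π t) (s • w t - v t) =
      (inner ℝ (f t) (y - curve y v t) + inner ℝ (π t) (-v t)) +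
        s * (inner ℝ (f t) (curve η w t) + inner ℝ (π t) (w t)) := by
    intro s t
    rw [hcurve, add_sub_right_comm, sub_eq_neg_add (s • w t), inner_add_right, inner_add_right,
      inner_smul_right, inner_smul_right]
    ring
  have hend : ∀ s : ℝ, inner ℝ (gradient g (curve y v T))
      (curve (y + s • η) (fun t => s • w t) T - curve y v T) =
      inner ℝ (gradient g (curve y v T)) (y - curve y v T) +
        s * inner ℝ (gradient g (curve y v T)) (curve η w T) := by
    intro s
    rw [hcurve, add_sub_right_comm, inner_add_right, inner_smul_right]
  simp only [hexp, hend, add_sub_cancel_left, inner_smul_right] at hvar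
  have h0 : Integrable (fun t => inner ℝ (f t) (y - curve y v t) + inner ℝ (π t) (-v t))
      (timeMeasure T) := by simpa using (hvar 0).1
  have hψ : Integrable (fun t => inner ℝ (f t) (curve η w t) + inner ℝ (π t) (w t))
      (timeMeasure T) := by
    refine ((hvar 1).1.sub' h0).congr (ae_of_all _ fun t => ?_)
    simp
  refine ⟨hψ, ?_⟩
  have hlin : ∀ s : ℝ, 0 ≤ (∫ t in Icc 0 T,
      (inner ℝ (f t) (y - curve y v t) + inner ℝ (π t) (-v t))) +
      inner ℝ (gradient g (curve y v T)) (y - curve y v T) +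
      s * ((∫ t in Icc 0 T, (inner ℝ (f t) (curve η w t) + inner ℝ (π t) (w t))) +
        inner ℝ (gradient g (curve y v T)) (curve η w T) - inner ℝ q η) := by
    intro s
    have h := (hvar s).2
    rw [integral_add h0 (hψ.const_mul s), integral_const_mul] at h
    linarith
  -- A nonzero slope would make this affine function of `s` take the value `-1`.
  by_contra hne
  have h := hlin (-((∫ t in Icc 0 T,
      (inner ℝ (f t) (y - curve y v t) + inner ℝ (π t) (-v t))) +
      inner ℝ (gradient g (curve y v T)) (y - curve y v T) + 1) /
      ((∫ t in Icc 0 T, (inner ℝ (f t) (curve η w t) + inner ℝ (π t) (w t))) +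
        inner ℝ (gradient g (curve y v T)) (curve η w T) - inner ℝ q η))
  rw [div_mul_cancel₀ _ hne] at h
  linarith

theorem integrable_of_forall_inner {α : Type*} [MeasurableSpace α] {μ : Measure α}
    {f : α → Vec d} (h : ∀ η : Vec d, Integrable (fun a => inner ℝ (f a) η) μ) :
    Integrable f μ := by
  have e : f = fun a => ∑ i, inner ℝ (f a) (EuclideanSpace.basisFun (Fin d) ℝ i) •
      EuclideanSpace.basisFun (Fin d) ℝ i := by
    funext a
    conv_lhs => rw [← (EuclideanSpace.basisFun (Fin d) ℝ).sum_repr' (f a)]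
    simp only [real_inner_comm]
  rw [e]
  exact integrable_finsetSum _ fun i _ => (h _).smul_const _

theorem ae_deriv_curve_eq (hT : 0 ≤ T) (y : Vec d) {v : ℝ → Vec d}
    (hv : IntervalIntegrable v volume 0 T) : deriv (curve y v) =ᵐ[timeMeasure T] v := by
  rw [Filter.EventuallyEq, ae_restrict_iff' measurableSet_Icc]
  filter_upwards [hv.ae_hasDerivAt_integral] with t ht ht'
  rw [← uIcc_of_le hT] at ht'
  exact ((ht ht' 0 left_mem_uIcc).const_add y).deriv

theorem IsMinimizer.isEulerLagrangeSolution (hL : LagrangianAssumption L c M)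
    (hgd : Differentiable ℝ g) (hg : ConvexOn ℝ univ g) (hT : 0 ≤ T)
    (hQ : MemLp Q 2 (timeMeasure T)) {y : Vec d} {v : ℝ → Vec d}
    (hv : IsMinimizer L c g T Q y v) :
    IsEulerLagrangeSolution L g T Q y (curve y v) := by
  obtain ⟨q, hq⟩ := (convexOn_valueFunction hL hg hT hQ).exists_subgradient y
  have hi := intervalIntegrable_of_memLp hT hv.admissible.memLp
  have hder := ae_deriv_curve_eq hT y hi
  set f : ℝ → Vec d := fun t => gradX L (curve y v t) (v t) (Q t)
  set π : ℝ → Vec d := fun t => gradV L (curve y v t) (v t) (Q t)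
  have hweak : ∀ (η : Vec d) {w : ℝ → Vec d}, AEStronglyMeasurable w (timeMeasure T) →
      ∀ {R : ℝ}, (∀ t, ‖w t‖ ≤ R) →
      Integrable (fun t => inner ℝ (f t) (curve η w t) + inner ℝ (π t) (w t)) (timeMeasure T) ∧
      (∫ t in Icc 0 T, (inner ℝ (f t) (curve η w t) + inner ℝ (π t) (w t))) +
        inner ℝ (gradient g (curve y v T)) (curve η w T) - inner ℝ q η = 0 :=
    fun η _ hw _ hR => hv.weak_eulerLagrange hL hgd hg hT hQ hq η hw hR
  have hconst : ∀ (η : Vec d) t, curve η (fun _ => 0) t = η := fun η t => by simp [curve]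
  have hlinear : ∀ (η : Vec d) t, curve 0 (fun _ => η) t = t • η := fun η t => by simp [curve]
  -- Constant variations show that the force is integrable, affine ones the momentum.
  have hf : Integrable f (timeMeasure T) := integrable_of_forall_inner fun η => by
    simpa [hconst] using (hweak η (w := fun _ => 0) aestronglyMeasurable_const (R := 0)
      (by simp)).1
  have hπ : Integrable π (timeMeasure T) := integrable_of_forall_inner fun η => by
    have h := (hweak 0 (w := fun _ => η) aestronglyMeasurable_const (R := ‖η‖) (by simp)).1
    simp only [hlinear, inner_smul_right] at h
    have h2 : Integrable (fun t => t * inner ℝ (f t) η) (timeMeasure T) :=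
      (hf.inner_const η).bdd_mul (c := T) aestronglyMeasurable_id (by
        filter_upwards [ae_restrict_mem measurableSet_Icc] with t ht
        rw [Real.norm_eq_abs, abs_of_nonneg ht.1]
        exact ht.2)
    refine (h.sub' h2).congr (ae_of_all _ fun t => ?_)
    simp
  have hfi : IntervalIntegrable f volume 0 T :=
    (intervalIntegrable_iff_integrableOn_Icc_of_le hT).2 hf
  set p₀ : Vec d := -gradient g (curve y v T) - ∫ s in (0 : ℝ)..T, f s
  have hpT : curve p₀ f T = -gradient g (curve y v T) := by simp [curve, p₀]
  have hpi : Integrable (curve p₀ f) (timeMeasure T) :=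
    (continuousOn_curve hT p₀ hfi).integrableOn_compact isCompact_Icc
  -- The du Bois-Reymond lemma: test with the unit vector field along the difference.
  have hmom : π =ᵐ[timeMeasure T] curve p₀ f := by
    set δ : ℝ → Vec d := fun t => π t - curve p₀ f t
    have hδ : Integrable δ (timeMeasure T) := hπ.sub hpi
    set w : ℝ → Vec d := fun t => ‖δ t‖⁻¹ • δ t
    have hw : AEStronglyMeasurable w (timeMeasure T) :=
      (hδ.aestronglyMeasurable.norm.aemeasurable.inv.aestronglyMeasurable).smul
        hδ.aestronglyMeasurable
    have hw1 : ∀ t, ‖w t‖ ≤ 1 := fun t => by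
      simp only [w, norm_smul, norm_inv, norm_norm]
      exact inv_mul_le_one
    have hwi : IntervalIntegrable w volume 0 T :=
      (intervalIntegrable_iff_integrableOn_Icc_of_le hT).2
        (Integrable.of_bound hw 1 (ae_of_all _ hw1))
    obtain ⟨h1, h2⟩ := hweak 0 hw hw1
    obtain ⟨h3, h4⟩ := intervalIntegral_inner_primitive hT hfi hwi (U := curve p₀ f)
      (W := curve 0 w) (a := p₀) (b := 0) (fun t _ => rfl) (fun t _ => rfl)
    rw [intervalIntegral.integral_of_le hT, ← integral_Icc_eq_integral_Ioc, hpT] at h4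
    have h3' : Integrable (fun t => inner ℝ (f t) (curve 0 w t) + inner ℝ (curve p₀ f t) (w t))
        (timeMeasure T) := (intervalIntegrable_iff_integrableOn_Icc_of_le hT).1 h3
    have h5 : ∫ t in Icc 0 T, ‖δ t‖ = 0 := by
      have e : ∀ t, ‖δ t‖ = (inner ℝ (f t) (curve 0 w t) + inner ℝ (π t) (w t)) -
          (inner ℝ (f t) (curve 0 w t) + inner ℝ (curve p₀ f t) (w t)) := by
        intro t
        rw [add_sub_add_left_eq_sub, ← inner_sub_left]
        change ‖δ t‖ = inner ℝ (δ t) (‖δ t‖⁻¹ • δ t)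
        rw [inner_smul_right, real_inner_self_eq_norm_sq]
        rcases eq_or_ne ‖δ t‖ 0 with h | h
        · simp [h]
        · field_simp
      simp_rw [e]
      rw [integral_sub h1 h3', h4]
      have e0 : curve 0 w 0 = 0 := by simp [curve]
      rw [e0, inner_neg_left]
      simp only [inner_zero_right, sub_zero] at h2 ⊢
      linarith
    have h6 := (integral_eq_zero_iff_of_nonneg (fun t => norm_nonneg (δ t)) hδ.norm).1 h5
    filter_upwards [h6] with t ht
    exact sub_eq_zero.1 (norm_eq_zero.1 ht)
  have hforce :
      (fun s => gradX L (curve y v s) (deriv (curve y v) s) (Q s)) =ᵐ[timeMeasure T] f := by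
    filter_upwards [hder] with t ht
    simp only [f, ht]
  refine ⟨(intervalIntegrable_iff_integrableOn_Icc_of_le hT).2
      ((hv.admissible.memLp.integrable one_le_two).congr hder.symm), fun t ht => ?_,
    (intervalIntegrable_iff_integrableOn_Icc_of_le hT).2 (hf.congr hforce.symm),
    curve p₀ f, ?_, fun t ht => ?_, hpT⟩
  · exact (curve_congr_ae y hder ht).symm
  · filter_upwards [hder, hmom] with t h1 h2
    rw [h1]
    exact h2
  · have h := curve_congr_ae p₀ hforce ht
    rw [← h]
    simp [curve]

end FirstVariation

/-! ### Stability and uniqueness of Euler–Lagrange solutions -/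

section Stability

open Filter Topology

variable {d : ℕ} {L : Vec d → Vec d → Vec d → ℝ} {c M : ℝ} {g : Vec d → ℝ} {T : ℝ}

theorem IsEulerLagrangeSolution.eq_curve {Q : ℝ → Vec d} {y : Vec d} {x : ℝ → Vec d}
    (h : IsEulerLagrangeSolution L g T Q y x) {t : ℝ} (ht : t ∈ Icc 0 T) :
    x t = curve y (deriv x) t := h.eq_integral t ht

/-- The velocities of two solutions with the same starting point differ in `L²` by at most
`√2 M / c` times the difference of the controls: the monotonicity estimate is integrated along the
two curves, and the boundary term has a sign because `g` is convex. -/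
theorem IsEulerLagrangeSolution.integral_norm_deriv_sub_sq_le (hL : LagrangianAssumption L c M)
    (hg : Differentiable ℝ g) (hg' : Differentiable ℝ (fderiv ℝ g))
    (hg'' : ∀ x ξ, 0 ≤ fderiv ℝ (fderiv ℝ g) x ξ ξ) (hT : 0 ≤ T) {Q₀ Q₁ : ℝ → Vec d}
    (hQ₀ : MemLp Q₀ 2 (timeMeasure T)) (hQ₁ : MemLp Q₁ 2 (timeMeasure T)) {y : Vec d}
    {x₀ x₁ : ℝ → Vec d} (h₀ : IsEulerLagrangeSolution L g T Q₀ y x₀)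
    (h₁ : IsEulerLagrangeSolution L g T Q₁ y x₁) :
    Integrable (fun t => ‖deriv x₁ t - deriv x₀ t‖ ^ 2) (timeMeasure T) ∧
    ∫ t in Icc 0 T, ‖deriv x₁ t - deriv x₀ t‖ ^ 2 ≤
      2 * M ^ 2 / c ^ 2 * ∫ t in Icc 0 T, ‖Q₁ t - Q₀ t‖ ^ 2 := by
  have hc := hL.c_pos
  obtain ⟨p₀, hp₀, hp₀i, hp₀T⟩ := h₀.exists_momentum
  obtain ⟨p₁, hp₁, hp₁i, hp₁T⟩ := h₁.exists_momentum
  obtain ⟨hψ, hψe⟩ := intervalIntegral_inner_primitive hT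
    (h₁.force_integrable.sub h₀.force_integrable)
    (h₁.velocity_integrable.sub h₀.velocity_integrable)
    (U := fun t => p₁ t - p₀ t) (W := fun t => x₁ t - x₀ t) (a := p₁ 0 - p₀ 0) (b := y - y)
    (fun t ht => by
      have := curve_add_sub (p₀ 0) (p₁ 0) h₀.force_integrable h₁.force_integrable ht
      rw [hp₁i t ht, hp₀i t ht]
      exact this.symm)
    (fun t ht => by
      have := curve_add_sub y y h₀.velocity_integrable h₁.velocity_integrable ht
      rw [h₁.eq_integral t ht, h₀.eq_integral t ht]
      exact this.symm)
  have hstart : x₁ 0 - x₀ 0 = 0 := by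
    rw [h₁.eq_integral 0 ⟨le_rfl, hT⟩, h₀.eq_integral 0 ⟨le_rfl, hT⟩]
    simp
  have hend : inner ℝ (p₁ T - p₀ T) (x₁ T - x₀ T) ≤ 0 := by
    have := inner_gradient_sub_nonneg hg hg' hg'' (x₀ T) (x₁ T)
    rw [hp₁T, hp₀T, neg_sub_neg, ← neg_sub (gradient g (x₁ T)), inner_neg_left]
    linarith
  rw [hstart, inner_zero_right, sub_zero, intervalIntegral.integral_of_le hT,
    ← integral_Icc_eq_integral_Ioc] at hψe
  have hψ' := (intervalIntegrable_iff_integrableOn_Icc_of_le hT).1 hψ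
  have hQi : Integrable (fun t => ‖Q₁ t - Q₀ t‖ ^ 2) (timeMeasure T) :=
    (hQ₁.sub hQ₀).norm.integrable_sq
  have hae : ∀ᵐ t ∂(timeMeasure T), c / 2 * ‖deriv x₁ t - deriv x₀ t‖ ^ 2 ≤
      inner ℝ (gradX L (x₁ t) (deriv x₁ t) (Q₁ t) - gradX L (x₀ t) (deriv x₀ t) (Q₀ t))
        (x₁ t - x₀ t) + inner ℝ (p₁ t - p₀ t) (deriv x₁ t - deriv x₀ t) +
        M ^ 2 / c * ‖Q₁ t - Q₀ t‖ ^ 2 := by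
    filter_upwards [hp₀, hp₁] with t e₀ e₁
    rw [← e₀, ← e₁]
    refine le_trans ?_ (hL.monotone_grad_param _ _ _ _ _ _)
    gcongr
    exact le_add_of_nonneg_left (sq_nonneg _)
  have hdm : AEStronglyMeasurable (fun t => ‖deriv x₁ t - deriv x₀ t‖ ^ 2) (timeMeasure T) :=
    (((intervalIntegrable_iff_integrableOn_Icc_of_le hT).1
      (h₁.velocity_integrable.sub h₀.velocity_integrable)).aestronglyMeasurable.norm).pow 2
  have hdi : Integrable (fun t => ‖deriv x₁ t - deriv x₀ t‖ ^ 2) (timeMeasure T) := by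
    refine Integrable.mono' ((hψ'.add (hQi.const_mul (M ^ 2 / c))).const_mul (2 / c)) hdm ?_
    filter_upwards [hae] with t ht
    rw [Real.norm_of_nonneg (sq_nonneg _)]
    have h := mul_le_mul_of_nonneg_left ht (show 0 ≤ 2 / c by positivity)
    rwa [← mul_assoc, show 2 / c * (c / 2) = 1 by field_simp, one_mul] at h
  refine ⟨hdi, ?_⟩
  have h := integral_mono_ae (hdi.const_mul (c / 2)) (hψ'.add (hQi.const_mul (M ^ 2 / c))) hae
  rw [integral_add' hψ' (hQi.const_mul _), hψe, integral_const_mul, integral_const_mul] at h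
  have h' : c / 2 * ∫ t in Icc 0 T, ‖deriv x₁ t - deriv x₀ t‖ ^ 2 ≤
      M ^ 2 / c * ∫ t in Icc 0 T, ‖Q₁ t - Q₀ t‖ ^ 2 := by linarith
  have h'' := mul_le_mul_of_nonneg_left h' (show 0 ≤ 2 / c by positivity)
  rw [← mul_assoc, show 2 / c * (c / 2) = 1 by field_simp, one_mul, ← mul_assoc] at h''
  refine h''.trans_eq ?_
  congr 1
  field_simp

theorem IsEulerLagrangeSolution.eqOn (hL : LagrangianAssumption L c M)
    (hg : Differentiable ℝ g) (hg' : Differentiable ℝ (fderiv ℝ g))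
    (hg'' : ∀ x ξ, 0 ≤ fderiv ℝ (fderiv ℝ g) x ξ ξ) (hT : 0 ≤ T) {Q : ℝ → Vec d}
    (hQ : MemLp Q 2 (timeMeasure T)) {y : Vec d}
    {x₀ x₁ : ℝ → Vec d} (h₀ : IsEulerLagrangeSolution L g T Q y x₀)
    (h₁ : IsEulerLagrangeSolution L g T Q y x₁) : EqOn x₁ x₀ (Icc 0 T) := by
  obtain ⟨hi, hle⟩ := h₀.integral_norm_deriv_sub_sq_le hL hg hg' hg'' hT hQ hQ h₁
  simp only [sub_self, norm_zero, ne_eq, OfNat.ofNat_ne_zero, not_false_eq_true, zero_pow,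
    integral_zero, mul_zero] at hle
  have h0 := (integral_eq_zero_iff_of_nonneg (fun t => sq_nonneg _) hi).1
    (le_antisymm hle (integral_nonneg fun t => sq_nonneg _))
  have hae : deriv x₁ =ᵐ[timeMeasure T] deriv x₀ := by
    filter_upwards [h0] with t ht
    have : ‖deriv x₁ t - deriv x₀ t‖ ^ 2 = 0 := ht
    exact sub_eq_zero.1 (norm_eq_zero.1 (pow_eq_zero_iff two_ne_zero |>.1 this))
  intro t ht
  rw [h₁.eq_curve ht, h₀.eq_curve ht]
  exact curve_congr_ae y hae ht

theorem isEulerLagrangeSolution_trajectory (hL : LagrangianAssumption L c M)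
    (hgd : Differentiable ℝ g) (hg : ConvexOn ℝ univ g) (hT : 0 ≤ T) {Q : ℝ → Vec d}
    (hQ : MemLp Q 2 (timeMeasure T)) (y : Vec d) :
    IsEulerLagrangeSolution L g T Q y (trajectory L g T Q y) := by
  obtain ⟨v, hv⟩ := exists_isMinimizer (g := g) hL hg hT hQ y
  have h : ∃ x, IsEulerLagrangeSolution L g T Q y x :=
    ⟨_, hv.isEulerLagrangeSolution hL hgd hg hT hQ⟩
  rw [trajectory, dif_pos h]
  exact h.choose_spec

/-! ### Measurable dependence on the starting point -/

/-- The trajectories, frozen outside of the time interval, depend continuously on the starting point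
and time. -/
theorem continuous_trajectory (hL : LagrangianAssumption L c M)
    (hg : Differentiable ℝ g) (hg' : Differentiable ℝ (fderiv ℝ g))
    (hg'' : ∀ x ξ, 0 ≤ fderiv ℝ (fderiv ℝ g) x ξ ξ) (hT : 0 ≤ T) {Q : ℝ → Vec d}
    (hQ : MemLp Q 2 (timeMeasure T)) :
    Continuous (fun z : Vec d × ℝ => trajectory L g T Q z.1 (projIcc 0 T hT z.2)) := by
  have hc := hL.c_pos
  have hgc := convexOn_of_hessian_nonneg hg hg' hg''
  choose v hv using exists_isMinimizer (g := g) hL hgc hT hQ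
  have htraj : ∀ y, ∀ t ∈ Icc 0 T, trajectory L g T Q y t = curve y (v y) t := fun y t ht =>
    ((hv y).isEulerLagrangeSolution hL hg hgc hT hQ).eqOn hL hg hg' hg'' hT hQ
      (isEulerLagrangeSolution_trajectory hL hg hgc hT hQ y) ht
  simp_rw [fun z : Vec d × ℝ => htraj z.1 _ (projIcc 0 T hT z.2).2]
  have hV : Continuous (valueFunction L c g T Q) :=
    (convexOn_valueFunction hL hgc hT hQ).locallyLipschitz.continuous
  rw [continuous_iff_continuousAt]
  rintro ⟨y₀, t₀⟩
  set gap : Vec d → ℝ := fun y =>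
    (valueFunction L c g T Q y₀ + valueFunction L c g T Q y) / 2 -
      valueFunction L c g T Q (y₀ + (1 / 2 : ℝ) • (y - y₀))
  have hgap : Continuous gap := by
    simp only [gap]
    exact ((continuous_const.add hV).div_const 2).sub (hV.comp (by fun_prop))
  have hpath : Continuous (fun t : ℝ => curve y₀ (v y₀) (projIcc 0 T hT t)) :=
    (continuousOn_curve hT y₀
      (intervalIntegrable_of_memLp hT (hv y₀).admissible.memLp)).comp_continuous
      (continuous_subtype_val.comp continuous_projIcc) fun t => (projIcc 0 T hT t).2
  rw [ContinuousAt, tendsto_iff_norm_sub_tendsto_zero]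
  set bound : Vec d × ℝ → ℝ := fun z => (‖z.1 - y₀‖ + √(T * (8 / c * gap z.1))) +
    ‖curve y₀ (v y₀) (projIcc 0 T hT z.2) - curve y₀ (v y₀) (projIcc 0 T hT t₀)‖
  have hb : Continuous bound := by
    simp only [bound]
    have h1 : Continuous fun z : Vec d × ℝ => gap z.1 := hgap.comp continuous_fst
    have h2 : Continuous fun z : Vec d × ℝ => curve y₀ (v y₀) (projIcc 0 T hT z.2) :=
      hpath.comp continuous_snd
    fun_prop
  have hb0 : bound (y₀, t₀) = 0 := by simp [bound, gap]
  refine squeeze_zero (fun _ => norm_nonneg _) (fun z => ?_) (hb0 ▸ hb.tendsto (y₀, t₀))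
  refine (norm_sub_le_norm_sub_add_norm_sub _
    (curve y₀ (v y₀) (projIcc 0 T hT z.2)) _).trans (add_le_add_left ?_ _)
  refine (norm_curve_sub_le y₀ z.1 (hv y₀).admissible.memLp (hv z.1).admissible.memLp
    (projIcc 0 T hT z.2).2).trans (add_le_add_right (Real.sqrt_le_sqrt ?_) _)
  refine mul_le_mul_of_nonneg_left ?_ hT
  have h := (hv y₀).integral_norm_sub_sq_le hL hgc hT hQ (hv z.1)
  have h' := mul_le_mul_of_nonneg_left h (show 0 ≤ 8 / c by positivity)
  rwa [← mul_assoc, show 8 / c * (c / 8) = 1 by field_simp, one_mul] at h'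

/-- The definition of `trajectory` picks a solution for each starting point separately, and its
values outside of `[0, T]` are arbitrary; its velocity is still measurable in both variables up to
a null set of times, the same for all starting points. -/
theorem exists_measurable_velocity (hL : LagrangianAssumption L c M)
    (hg : Differentiable ℝ g) (hg' : Differentiable ℝ (fderiv ℝ g))
    (hg'' : ∀ x ξ, 0 ≤ fderiv ℝ (fderiv ℝ g) x ξ ξ) (hT : 0 ≤ T) {Q : ℝ → Vec d}
    (hQ : MemLp Q 2 (timeMeasure T)) :
    ∃ D : Vec d × ℝ → Vec d, Measurable D ∧
      ∀ᵐ t ∂(timeMeasure T), ∀ y, deriv (trajectory L g T Q y) t = D (y, t) := by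
  refine ⟨_, measurable_deriv_with_param
    (f := fun y t => trajectory L g T Q y (projIcc 0 T hT t))
    (continuous_trajectory hL hg hg' hg'' hT hQ), ?_⟩
  -- At interior times the derivative sees only the values on `[0, T]`; the endpoints are null.
  rw [timeMeasure, ← Measure.restrict_congr_set Ioo_ae_eq_Icc]
  filter_upwards [ae_restrict_mem measurableSet_Ioo] with t ht y
  refine Filter.EventuallyEq.deriv_eq ?_
  filter_upwards [Ioo_mem_nhds ht.1 ht.2] with s hs
  rw [projIcc_of_mem hT ⟨hs.1.le, hs.2.le⟩]

end Stability

/-! ### Averaging over the starting point -/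

theorem memLp_two_integral_prod {α β F : Type*} [MeasurableSpace α] [MeasurableSpace β]
    [NormedAddCommGroup F] [NormedSpace ℝ F] {m : Measure α} [IsProbabilityMeasure m]
    {μ : Measure β} [IsFiniteMeasure μ] {R : α × β → F} (hR : StronglyMeasurable R) {B : ℝ}
    (hint : ∀ a, Integrable (fun b => ‖R (a, b)‖ ^ 2) μ)
    (hB : ∀ a, ∫ b, ‖R (a, b)‖ ^ 2 ∂μ ≤ B) :
    (∀ᵐ b ∂μ, Integrable (fun a => R (a, b)) m) ∧
    MemLp (fun b => ∫ a, R (a, b) ∂m) 2 μ ∧ ∫ b, ‖∫ a, R (a, b) ∂m‖ ^ 2 ∂μ ≤ B := by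
  have hsq : StronglyMeasurable (fun z => ‖R z‖ ^ 2) := hR.norm.pow 2
  have hF : Integrable (fun z => ‖R z‖ ^ 2) (m.prod μ) := by
    rw [integrable_prod_iff hsq.aestronglyMeasurable]
    refine ⟨ae_of_all _ hint, Integrable.of_bound
      (hsq.norm.integral_prod_right (ν := μ)).aestronglyMeasurable B (ae_of_all _ fun a => ?_)⟩
    simp only [norm_pow, norm_norm]
    rw [Real.norm_of_nonneg (integral_nonneg fun b => sq_nonneg _)]
    exact hB a
  have hslice : ∀ b, AEStronglyMeasurable (fun a => R (a, b)) m := fun b =>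
    (hR.comp_measurable measurable_prodMk_right).aestronglyMeasurable
  have hmem : ∀ᵐ b ∂μ, MemLp (fun a => R (a, b)) 2 m := by
    filter_upwards [hF.prod_left_ae] with b hb
    exact (memLp_two_iff_integrable_sq_norm (hslice b)).2 hb
  have hle : ∀ᵐ b ∂μ, ‖∫ a, R (a, b) ∂m‖ ^ 2 ≤ ∫ a, ‖R (a, b)‖ ^ 2 ∂m := by
    filter_upwards [hmem] with b hb
    calc ‖∫ a, R (a, b) ∂m‖ ^ 2 ≤ (∫ a, ‖R (a, b)‖ ∂m) ^ 2 :=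
          pow_le_pow_left₀ (norm_nonneg _) (norm_integral_le_integral_norm _) 2
      _ ≤ ∫ a, ‖R (a, b)‖ ^ 2 ∂m := by simpa using sq_integral_le_measureReal_mul hb.norm
  have hWm : AEStronglyMeasurable (fun b => ∫ a, R (a, b) ∂m) μ :=
    (hR.integral_prod_left' (μ := m)).aestronglyMeasurable
  have hWi : Integrable (fun b => ‖∫ a, R (a, b) ∂m‖ ^ 2) μ :=
    Integrable.mono' hF.integral_prod_right (hWm.norm.pow 2) (by
      filter_upwards [hle] with b hb
      rwa [Real.norm_of_nonneg (sq_nonneg _)])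
  refine ⟨hmem.mono fun b hb => hb.integrable one_le_two,
    (memLp_two_iff_integrable_sq_norm hWm).2 hWi, ?_⟩
  calc ∫ b, ‖∫ a, R (a, b) ∂m‖ ^ 2 ∂μ ≤ ∫ b, ∫ a, ‖R (a, b)‖ ^ 2 ∂m ∂μ :=
        integral_mono_ae hWi hF.integral_prod_right hle
    _ = ∫ a, ∫ b, ‖R (a, b)‖ ^ 2 ∂μ ∂m := (integral_integral_swap hF).symm
    _ ≤ ∫ _, B ∂m := integral_mono hF.integral_prod_left (integrable_const B) hB
    _ = B := by simp

/-- The mean velocities for two controls differ by a square integrable function, whose norm is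
controlled by the difference of the controls. -/
theorem exists_memLp_mean_velocity_sub {d : ℕ} {L : Vec d → Vec d → Vec d → ℝ} {c M : ℝ}
    {g : Vec d → ℝ} {T : ℝ} (hL : LagrangianAssumption L c M)
    (hg : Differentiable ℝ g) (hg' : Differentiable ℝ (fderiv ℝ g))
    (hg'' : ∀ x ξ, 0 ≤ fderiv ℝ (fderiv ℝ g) x ξ ξ) (hT : 0 ≤ T)
    (m : Measure (Vec d)) [IsProbabilityMeasure m] {Q₀ Q₁ : ℝ → Vec d}
    (hQ₀ : MemLp Q₀ 2 (timeMeasure T)) (hQ₁ : MemLp Q₁ 2 (timeMeasure T)) :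
    ∃ W : ℝ → Vec d, MemLp W 2 (timeMeasure T) ∧
      ∫ t in Icc 0 T, ‖W t‖ ^ 2 ≤ 2 * M ^ 2 / c ^ 2 * ∫ t in Icc 0 T, ‖Q₁ t - Q₀ t‖ ^ 2 ∧
      ∀ᵐ t ∂(timeMeasure T), Integrable (fun y => deriv (trajectory L g T Q₀ y) t) m →
        Integrable (fun y => deriv (trajectory L g T Q₁ y) t) m ∧
        ∫ y, deriv (trajectory L g T Q₁ y) t ∂m =
          (∫ y, deriv (trajectory L g T Q₀ y) t ∂m) + W t := by
  have hgc := convexOn_of_hessian_nonneg hg hg' hg''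
  obtain ⟨D₀, hD₀, e₀⟩ := exists_measurable_velocity hL hg hg' hg'' hT hQ₀
  obtain ⟨D₁, hD₁, e₁⟩ := exists_measurable_velocity hL hg hg' hg'' hT hQ₁
  have hstab := fun y => (isEulerLagrangeSolution_trajectory hL hg hgc hT hQ₀ y
    ).integral_norm_deriv_sub_sq_le hL hg hg' hg'' hT hQ₀ hQ₁
      (isEulerLagrangeSolution_trajectory hL hg hgc hT hQ₁ y)
  have heq : ∀ y,
      (fun t => ‖deriv (trajectory L g T Q₁ y) t - deriv (trajectory L g T Q₀ y) t‖ ^ 2)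
      =ᵐ[timeMeasure T] fun t => ‖D₁ (y, t) - D₀ (y, t)‖ ^ 2 := fun y => by
    filter_upwards [e₀, e₁] with t h₀ h₁
    rw [h₀ y, h₁ y]
  obtain ⟨h1, h2, h3⟩ := memLp_two_integral_prod (m := m) (μ := timeMeasure T)
    (R := fun z => D₁ z - D₀ z) (hD₁.sub hD₀).stronglyMeasurable
    (fun y => (hstab y).1.congr (heq y))
    (fun y => (integral_congr_ae (heq y)).symm.trans_le (hstab y).2)
  refine ⟨_, h2, h3, ?_⟩
  filter_upwards [h1, e₀, e₁] with t ht h₀ h₁ hi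
  simp_rw [h₀] at hi ⊢
  simp_rw [h₁]
  have hi₁ : Integrable (fun y => D₁ (y, t)) m :=
    (hi.add ht).congr (ae_of_all _ fun y => by simp)
  refine ⟨hi₁, ?_⟩
  rw [integral_sub hi₁ hi]
  abel

theorem errorMapDefinedAt_of_errorMapDefinedAt {d : ℕ} {L : Vec d → Vec d → Vec d → ℝ} {c M : ℝ}
    {g : Vec d → ℝ} {T : ℝ} (hL : LagrangianAssumption L c M)
    (hg : Differentiable ℝ g) (hg' : Differentiable ℝ (fderiv ℝ g))
    (hg'' : ∀ x ξ, 0 ≤ fderiv ℝ (fderiv ℝ g) x ξ ξ) (hT : 0 ≤ T)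
    {m : Measure (Vec d)} [IsProbabilityMeasure m] {Q₀ Q₁ : ℝ → Vec d}
    (hQ₀ : MemLp Q₀ 2 (timeMeasure T)) (hQ₁ : MemLp Q₁ 2 (timeMeasure T))
    (h₀ : ErrorMapDefinedAt L g T m Q₀) : ErrorMapDefinedAt L g T m Q₁ := by
  obtain ⟨W, hW, -, hae⟩ := exists_memLp_mean_velocity_sub hL hg hg' hg'' hT m hQ₀ hQ₁
  constructor
  · filter_upwards [hae, h₀.integrable] with t h hi
    exact (h hi).1
  · refine (memLp_congr_ae ?_).2 ((h₀.memLp.add (hQ₁.sub hQ₀)).add hW)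
    filter_upwards [hae, h₀.integrable] with t h hi
    simp only [errorMap, (h hi).2, Pi.add_apply, Pi.sub_apply]
    abel

theorem mainTheorem1 {d : ℕ}
    (L : EuclideanSpace ℝ (Fin d) → EuclideanSpace ℝ (Fin d) → EuclideanSpace ℝ (Fin d) → ℝ)
    (c M : ℝ) (hL : LagrangianAssumption L c M)
    (g : EuclideanSpace ℝ (Fin d) → ℝ)
    (hg : Differentiable ℝ g) (hg' : Differentiable ℝ (fderiv ℝ g))
    (hg'' : ∀ x ξ : EuclideanSpace ℝ (Fin d), 0 ≤ fderiv ℝ (fderiv ℝ g) x ξ ξ)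
    (T : ℝ) (hT : 0 < T)
    (m₀ : Measure (EuclideanSpace ℝ (Fin d))) [IsProbabilityMeasure m₀]
    (hm₀ : ∃ Q : ℝ → EuclideanSpace ℝ (Fin d),
      MemLp Q 2 (volume.restrict (Icc (0 : ℝ) T)) ∧ ErrorMapDefinedAt L g T m₀ Q) :
    (∀ Q : ℝ → EuclideanSpace ℝ (Fin d), MemLp Q 2 (volume.restrict (Icc (0 : ℝ) T)) →
      (∀ x₀ : EuclideanSpace ℝ (Fin d), ∃ x : ℝ → EuclideanSpace ℝ (Fin d),
        IsEulerLagrangeSolution L g T Q x₀ x ∧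
        ∀ x' : ℝ → EuclideanSpace ℝ (Fin d), IsEulerLagrangeSolution L g T Q x₀ x' →
          EqOn x' x (Icc (0 : ℝ) T)) ∧
      ErrorMapDefinedAt L g T m₀ Q) ∧
    ∃ δ : ℝ, δ < 1 ∧
      ∀ Q₀ Q₁ : ℝ → EuclideanSpace ℝ (Fin d),
        MemLp Q₀ 2 (volume.restrict (Icc (0 : ℝ) T)) →
        MemLp Q₁ 2 (volume.restrict (Icc (0 : ℝ) T)) →
        (1 - δ) * ∫ t in Icc (0 : ℝ) T, ‖Q₁ t - Q₀ t‖ ^ 2 ≤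
          ∫ t in Icc (0 : ℝ) T,
            inner ℝ (errorMap L g T m₀ Q₁ t - errorMap L g T m₀ Q₀ t) (Q₁ t - Q₀ t) := by
  have hc := hL.c_pos
  have hgc := convexOn_of_hessian_nonneg hg hg' hg''
  obtain ⟨Qref, hQref, hdef⟩ := hm₀
  have hdefined : ∀ Q : ℝ → Vec d, MemLp Q 2 (timeMeasure T) → ErrorMapDefinedAt L g T m₀ Q :=
    fun Q hQ => errorMapDefinedAt_of_errorMapDefinedAt hL hg hg' hg'' hT.le hQref hQ hdef
  refine ⟨fun Q hQ => ⟨fun y => ⟨trajectory L g T Q y, ?_, fun x' hx' => ?_⟩, hdefined Q hQ⟩,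
    (1 + 2 * M ^ 2 / c ^ 2) / 2, ?_, fun Q₀ Q₁ hQ₀ hQ₁ => ?_⟩
  · exact isEulerLagrangeSolution_trajectory hL hg hgc hT.le hQ y
  · exact (isEulerLagrangeSolution_trajectory hL hg hgc hT.le hQ y).eqOn
      hL hg hg' hg'' hT.le hQ hx'
  · have : 2 * M ^ 2 / c ^ 2 < 1 := (div_lt_one (by positivity)).2 hL.dominance
    linarith
  · obtain ⟨W, hW, hWle, hae⟩ :=
      exists_memLp_mean_velocity_sub hL hg hg' hg'' hT.le m₀ hQ₀ hQ₁
    have hsub : MemLp (fun t => Q₁ t - Q₀ t) 2 (timeMeasure T) := hQ₁.sub hQ₀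
    have hE : (fun t => inner ℝ (errorMap L g T m₀ Q₁ t - errorMap L g T m₀ Q₀ t) (Q₁ t - Q₀ t))
        =ᵐ[timeMeasure T] fun t => ‖Q₁ t - Q₀ t‖ ^ 2 + inner ℝ (W t) (Q₁ t - Q₀ t) := by
      filter_upwards [hae, (hdefined Q₀ hQ₀).integrable] with t h hi
      have e : errorMap L g T m₀ Q₁ t - errorMap L g T m₀ Q₀ t = (Q₁ t - Q₀ t) + W t := by
        simp only [errorMap, (h hi).2]
        abel
      rw [e, inner_add_left, real_inner_self_eq_norm_sq]
    have i1 : Integrable (fun t => ‖Q₁ t - Q₀ t‖ ^ 2) (timeMeasure T) := hsub.norm.integrable_sq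
    have i2 : Integrable (fun t => ‖W t‖ ^ 2) (timeMeasure T) := hW.norm.integrable_sq
    have i3 : Integrable (fun t => inner ℝ (W t) (Q₁ t - Q₀ t)) (timeMeasure T) :=
      (i1.add i2).mono' (hW.1.inner hsub.1) (ae_of_all _ fun t => by
        have h1 := norm_inner_le_norm (𝕜 := ℝ) (W t) (Q₁ t - Q₀ t)
        have h2 := sq_nonneg (‖W t‖ - ‖Q₁ t - Q₀ t‖)
        have h3 := sq_nonneg ‖W t‖
        have h4 := sq_nonneg ‖Q₁ t - Q₀ t‖
        simp only [Pi.add_apply]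
        linarith)
    rw [integral_congr_ae hE, integral_add i1 i3]
    -- Together with the bound on `W`, Young's inequality produces the constant
    -- `δ = (1 + 2 M² / c²) / 2`.
    have hlow : ∫ t in Icc 0 T, (-(1 / 2) * (‖W t‖ ^ 2 + ‖Q₁ t - Q₀ t‖ ^ 2)) ≤
        ∫ t in Icc 0 T, inner ℝ (W t) (Q₁ t - Q₀ t) := by
      refine integral_mono ((i2.add i1).const_mul _) i3 fun t => ?_
      have h1 := neg_le_of_abs_le (abs_real_inner_le_norm (W t) (Q₁ t - Q₀ t))
      have h2 := sq_nonneg (‖W t‖ - ‖Q₁ t - Q₀ t‖)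
      dsimp only
      linarith
    rw [integral_const_mul, integral_add i2 i1] at hlow
    linarith
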